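/- Let $\mathbb{K}$ be a field of characteristic zero and let $\mathbf{Ch}(\mathbb{K})$ be the category of (possibly unbounded) chain complexes of $\mathbb{K}$-vector spaces, with its usual symmetric monoidal structure (Koszul signs). A unital Lie algebra in $\mathbf{Ch}(\mathbb{K})$ is a chain complex $V$ with a chain map $[\cdot,\cdot]:V\otimes V\to V$ and a chain map $\eta:\mathbb{K}\to V$, i.e. a cycle $\mathbb{1}=\eta(1)\in V_0$, such that the bracket is graded antisymmetric, satisfies the graded Jacobi identity, and $[v,\mathbb{1}]=0$ for all $v\in V$; morphisms are chain maps preserving bracket and unit. Denote their category by $\mathbf{Alg}_{\mathsf{uLie}}$, and let $\mathbf{Alg}_{\mathsf{As}}$ be the category of associative unital algebras in $\mathbf{Ch}(\mathbb{K})$, i.e. of (not necessarily commutative, possibly zero) unital differential graded algebras. The unital universal enveloping algebra functor $\phi_!:\mathbf{Alg}_{\mathsf{uLie}}\to\mathbf{Alg}_{\mathsf{As}}$ sends $V$ to the differential graded algebra $\phi_!(V)=T^{\otimes}V/\mathcal{I}$, the quotient of the tensor algebra $T^\otimes V=\bigoplus_{m\ge 0}V^{\otimes m}$ by the two-sided differential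 graded ideal generated by the relations $$v_1\otimes v_2-(-1)^{|v_1||v_2|}\,v_2\otimes v_1=[v_1,v_2],\qquad \mathbb{1}_\otimes=\mathbb{1},$$ for all homogeneous $v_1,v_2\in V$, where $\mathbb{1}_\otimes$ is the unit of $T^\otimes V$; its differential and grading are induced from those of $V$, and a morphism $f$ is sent to the algebra map that extends $f$ multiplicatively. Call a morphism in $\mathbf{Alg}_{\mathsf{uLie}}$ or $\mathbf{Alg}_{\mathsf{As}}$ a weak equivalence if its underlying chain map is a quasi-isomorphism. Then $\phi_!$ preserves weak equivalences: if $f:V\to V'$ is a weak equivalence in $\mathbf{Alg}_{\mathsf{uLie}}$, then $\phi_!(f):\phi_!(V)\to\phi_!(V')$ is a weak equivalence in $\mathbf{Alg}_{\mathsf{As}}$. -/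

import Mathlib

open CategoryTheory

universe u v

/-- A unital Lie algebra in chain complexes of `K`-vector spaces (unbounded, homological grading):
a chain complex `X` with a degree-zero chain map `[·,·] : X ⊗ X ⟶ X` and a chain map `K ⟶ X`,
i.e. a cycle `one` of degree `0`. The equality `h : i + j = k` carried by `bracket h` only spares us
casts between `X_{(i+j)+k}` and `X_{i+(j+k)}`. Signs follow the Koszul rule. -/
structure ULieAlg (K : Type u) [Field K] where
  /-- the underlying chain complex -/
  X : ChainComplex (ModuleCat.{v} K) ℤ
  /-- the Lie bracket `X_i ⊗ X_j → X_k`, `i + j = k` -/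
  bracket : ∀ {i j k : ℤ}, i + j = k → X.X i →ₗ[K] X.X j →ₗ[K] X.X k
  /-- the unit element -/
  one : X.X 0
  /-- the unit is a cycle -/
  d_one : (X.d 0 (-1)).hom one = 0
  /-- the bracket is a chain map -/
  d_bracket : ∀ {i j k i' j' k' : ℤ} (h : i + j = k) (hi : i' + 1 = i) (hj : j' + 1 = j)
    (hk : k' + 1 = k) (a : X.X i) (b : X.X j),
    (X.d k k').hom (bracket h a b) =
      bracket (show i' + j = k' by omega) ((X.d i i').hom a) b +
        i.negOnePow • bracket (show i + j' = k' by omega) a ((X.d j j').hom b)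
  /-- graded antisymmetry -/
  antisymm : ∀ {i j k : ℤ} (h : i + j = k) (a : X.X i) (b : X.X j),
    bracket h a b = -((i * j).negOnePow • bracket (show j + i = k by omega) b a)
  /-- graded Jacobi identity -/
  jacobi : ∀ {i j k ij jk ki n : ℤ} (hij : i + j = ij) (hjk : j + k = jk) (hki : k + i = ki)
    (hn : i + jk = n) (a : X.X i) (b : X.X j) (c : X.X k),
    (i * k).negOnePow • bracket hn a (bracket hjk b c) +
      (j * i).negOnePow • bracket (show j + ki = n by omega) b (bracket hki c a) +
      (k * j).negOnePow • bracket (show k + ij = n by omega) c (bracket hij a b) = 0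
  /-- the bracket with the unit vanishes -/
  bracket_one : ∀ {i : ℤ} (a : X.X i), bracket (add_zero i) a one = 0

/-- An associative unital algebra in chain complexes of `K`-vector spaces, i.e. a (not necessarily
commutative) differential graded algebra. The zero algebra is allowed. -/
structure AsAlg (K : Type u) [Field K] where
  /-- the underlying chain complex -/
  X : ChainComplex (ModuleCat.{v} K) ℤ
  /-- the multiplication `X_i ⊗ X_j → X_k`, `i + j = k` -/
  mul : ∀ {i j k : ℤ}, i + j = k → X.X i →ₗ[K] X.X j →ₗ[K] X.X k
  /-- the unit element -/
  one : X.X 0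
  /-- the unit is a cycle -/
  d_one : (X.d 0 (-1)).hom one = 0
  /-- the multiplication is a chain map -/
  d_mul : ∀ {i j k i' j' k' : ℤ} (h : i + j = k) (hi : i' + 1 = i) (hj : j' + 1 = j)
    (hk : k' + 1 = k) (a : X.X i) (b : X.X j),
    (X.d k k').hom (mul h a b) =
      mul (show i' + j = k' by omega) ((X.d i i').hom a) b +
        i.negOnePow • mul (show i + j' = k' by omega) a ((X.d j j').hom b)
  /-- associativity -/
  mul_assoc : ∀ {i j k ij jk n : ℤ} (hij : i + j = ij) (hjk : j + k = jk) (hn : ij + k = n)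
    (a : X.X i) (b : X.X j) (c : X.X k),
    mul hn (mul hij a b) c = mul (show i + jk = n by omega) a (mul hjk b c)
  /-- left unitality -/
  one_mul : ∀ {i : ℤ} (a : X.X i), mul (zero_add i) one a = a
  /-- right unitality -/
  mul_one : ∀ {i : ℤ} (a : X.X i), mul (add_zero i) a one = a

section

variable {K : Type u} [Field K]

namespace ULieAlg

/-- Morphisms of unital Lie algebras: chain maps compatible with bracket and unit. -/
@[ext]
structure Hom (V W : ULieAlg.{u, v} K) where
  /-- the underlying chain map -/
  hom : V.X ⟶ W.X
  map_bracket : ∀ {i j k : ℤ} (h : i + j = k) (a : V.X.X i) (b : V.X.X j),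
    (hom.f k).hom (V.bracket h a b) = W.bracket h ((hom.f i).hom a) ((hom.f j).hom b)
  map_one : (hom.f 0).hom V.one = W.one

instance : Category (ULieAlg.{u, v} K) where
  Hom := Hom
  id V := ⟨𝟙 _, by intros; simp, by simp⟩
  comp f g := ⟨f.hom ≫ g.hom, by intros; simp [f.map_bracket, g.map_bracket],
    by simp [f.map_one, g.map_one]⟩
  id_comp f := Hom.ext (Category.id_comp f.hom)
  comp_id f := Hom.ext (Category.comp_id f.hom)
  assoc f g h := Hom.ext (Category.assoc f.hom g.hom h.hom)

end ULieAlg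

namespace AsAlg

/-- Morphisms of differential graded algebras: chain maps compatible with product and unit. -/
@[ext]
structure Hom (A B : AsAlg.{u, v} K) where
  /-- the underlying chain map -/
  hom : A.X ⟶ B.X
  map_mul : ∀ {i j k : ℤ} (h : i + j = k) (a : A.X.X i) (b : A.X.X j),
    (hom.f k).hom (A.mul h a b) = B.mul h ((hom.f i).hom a) ((hom.f j).hom b)
  map_one : (hom.f 0).hom A.one = B.one

instance : Category (AsAlg.{u, v} K) where
  Hom := Hom
  id V := ⟨𝟙 _, by intros; simp, by simp⟩
  comp f g := ⟨f.hom ≫ g.hom, by intros; simp [f.map_mul, g.map_mul],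
    by simp [f.map_one, g.map_one]⟩
  id_comp f := Hom.ext (Category.id_comp f.hom)
  comp_id f := Hom.ext (Category.comp_id f.hom)
  assoc f g h := Hom.ext (Category.assoc f.hom g.hom h.hom)

end AsAlg

namespace ULieAlg

open scoped DirectSum

/-- The total vector space `⨁ i, V_i` of a unital Lie algebra. -/
abbrev Tot (V : ULieAlg.{u, v} K) : Type v := ⨁ i : ℤ, (V.X.X i : Type v)

/-- The degree-`i` part of `V` as generators of the tensor algebra of `V`. -/
noncomputable def tgen (V : ULieAlg.{u, v} K) (i : ℤ) : V.X.X i →ₗ[K] TensorAlgebra K V.Tot :=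
  TensorAlgebra.ι K ∘ₗ DirectSum.lof K ℤ (fun i => (V.X.X i : Type v)) i

/-- The relations of the unital universal enveloping algebra:
`a ⊗ b - (-1)^{|a||b|} b ⊗ a = [a, b]` for homogeneous `a`, `b`, and `1_V = 1_⊗`. -/
inductive EnvRel (V : ULieAlg.{u, v} K) : TensorAlgebra K V.Tot → TensorAlgebra K V.Tot → Prop
  | comm {i j k : ℤ} (h : i + j = k) (a : V.X.X i) (b : V.X.X j) :
      EnvRel V (V.tgen i a * V.tgen j b - (i * j).negOnePow • (V.tgen j b * V.tgen i a))
        (V.tgen k (V.bracket h a b))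
  | unit : EnvRel V (V.tgen 0 V.one) 1

/-- The algebra underlying the unital universal enveloping algebra: the quotient of the tensor
algebra by the two-sided ideal generated by the relations `EnvRel`. -/
def Env (V : ULieAlg.{u, v} K) : Type (max u v) := RingQuot (EnvRel V)

noncomputable instance (V : ULieAlg.{u, v} K) : Ring V.Env :=
  inferInstanceAs (Ring (RingQuot (EnvRel V)))

noncomputable instance (V : ULieAlg.{u, v} K) : Algebra K V.Env :=
  inferInstanceAs (Algebra K (RingQuot (EnvRel V)))

/-- The quotient map from the tensor algebra to the enveloping algebra. -/
noncomputable def envMk (V : ULieAlg.{u, v} K) : TensorAlgebra K V.Tot →ₐ[K] V.Env :=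
  RingQuot.mkAlgHom K (EnvRel V)

theorem envMk_surjective (V : ULieAlg.{u, v} K) : Function.Surjective V.envMk :=
  RingQuot.mkAlgHom_surjective K (EnvRel V)

/-- The canonical map from `V_i` to the unital universal enveloping algebra. -/
noncomputable def gen (V : ULieAlg.{u, v} K) (i : ℤ) : V.X.X i →ₗ[K] V.Env :=
  V.envMk.toLinearMap ∘ₗ V.tgen i

theorem gen_comm (V : ULieAlg.{u, v} K) {i j k : ℤ} (h : i + j = k) (a : V.X.X i) (b : V.X.X j) :
    V.gen i a * V.gen j b - (i * j).negOnePow • (V.gen j b * V.gen i a) =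
      V.gen k (V.bracket h a b) := by
  have : V.envMk _ = V.envMk _ := RingQuot.mkAlgHom_rel K (EnvRel.comm h a b)
  simpa [gen, Units.smul_def] using this

theorem gen_one (V : ULieAlg.{u, v} K) : V.gen 0 V.one = 1 := by
  have : V.envMk _ = V.envMk _ := RingQuot.mkAlgHom_rel K (EnvRel.unit (V := V))
  simpa [gen] using this

/-- The algebra map out of the enveloping algebra given by its values on homogeneous generators. -/
noncomputable def envLift (V : ULieAlg.{u, v} K) {B : Type*} [Ring B] [Algebra K B]
    (g : ∀ i, V.X.X i →ₗ[K] B)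
    (hg : ∀ {i j k : ℤ} (h : i + j = k) (a : V.X.X i) (b : V.X.X j),
      g i a * g j b - (i * j).negOnePow • (g j b * g i a) = g k (V.bracket h a b))
    (h1 : g 0 V.one = 1) : V.Env →ₐ[K] B :=
  RingQuot.liftAlgHom K ⟨TensorAlgebra.lift K (DirectSum.toModule K ℤ B g), by
    intro x y hxy
    cases hxy with
    | comm h a b => simpa [tgen, Units.smul_def] using hg h a b
    | unit => simpa [tgen] using h1⟩

@[simp] theorem envLift_gen (V : ULieAlg.{u, v} K) {B : Type*} [Ring B] [Algebra K B]
    (g : ∀ i, V.X.X i →ₗ[K] B) (hg) (h1) (i : ℤ) (a : V.X.X i) :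
    V.envLift g hg h1 (V.gen i a) = g i a := by
  refine (RingQuot.liftAlgHom_mkAlgHom_apply K _ _ _).trans ?_
  simp [tgen]

theorem env_induction (V : ULieAlg.{u, v} K) {p : V.Env → Prop} (one : p 1)
    (gen_mul : ∀ i (a : V.X.X i) x, p x → p (V.gen i a * x))
    (add : ∀ x y, p x → p y → p (x + y)) (smul : ∀ (c : K) x, p x → p (c • x)) (x : V.Env) :
    p x := by
  have key : ∀ x y, p y → p (V.envMk x * y) := by
    intro x
    induction x using TensorAlgebra.induction with
    | algebraMap r =>
      intro y hy
      rw [AlgHom.commutes, ← Algebra.smul_def]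
      exact smul r y hy
    | ι m =>
      intro y hy
      induction m using DirectSum.induction_on with
      | zero => simpa using smul 0 y hy
      | of i a => exact gen_mul i a y hy
      | add a b ha hb =>
        rw [map_add, map_add, add_mul]
        exact add _ _ ha hb
    | mul a b ha hb =>
      intro y hy
      rw [map_mul, _root_.mul_assoc]
      exact ha _ (hb _ hy)
    | add a b ha hb =>
      intro y hy
      rw [map_add, add_mul]
      exact add _ _ (ha _ hy) (hb _ hy)
  obtain ⟨x, rfl⟩ := V.envMk_surjective x
  simpa using key x 1 one

theorem env_hom_ext (V : ULieAlg.{u, v} K) {B : Type*} [Ring B] [Algebra K B]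
    {f g : V.Env →ₐ[K] B} (h : ∀ i a, f (V.gen i a) = g (V.gen i a)) : f = g := by
  refine AlgHom.ext fun x => ?_
  induction x using V.env_induction with
  | one => simp
  | gen_mul i a x hx => rw [map_mul, map_mul, h, hx]
  | add x y hx hy => rw [map_add, map_add, hx, hy]
  | smul c x hx => rw [map_smul, map_smul, hx]

/-- The degree-`n` part of the enveloping algebra: the span of the (possibly empty) products
`v_1 ⋯ v_m` of homogeneous elements of `V` with `|v_1| + ⋯ + |v_m| = n`. -/
noncomputable def envDeg (V : ULieAlg.{u, v} K) (n : ℤ) : Submodule K V.Env :=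
  Submodule.span K {x | ∃ l : List (Σ i : ℤ, V.X.X i),
    (l.map Sigma.fst).sum = n ∧ (l.map fun p => V.gen p.1 p.2).prod = x}

theorem one_mem_envDeg (V : ULieAlg.{u, v} K) : (1 : V.Env) ∈ V.envDeg 0 :=
  Submodule.subset_span ⟨[], by simp, by simp⟩

theorem gen_mem_envDeg (V : ULieAlg.{u, v} K) (i : ℤ) (a : V.X.X i) : V.gen i a ∈ V.envDeg i :=
  Submodule.subset_span ⟨[⟨i, a⟩], by simp, by simp⟩

theorem mul_mem_envDeg (V : ULieAlg.{u, v} K) {i j k : ℤ} (h : i + j = k) {x y : V.Env}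
    (hx : x ∈ V.envDeg i) (hy : y ∈ V.envDeg j) : x * y ∈ V.envDeg k := by
  subst h
  have hle : V.envDeg i * V.envDeg j ≤ V.envDeg (i + j) := by
    rw [envDeg, envDeg, Submodule.span_mul_span, envDeg]
    apply Submodule.span_mono
    rintro _ ⟨_, ⟨l, hl, rfl⟩, _, ⟨m, hm, rfl⟩, rfl⟩
    exact ⟨l ++ m, by simp [hl, hm], by simp⟩
  exact hle (Submodule.mul_mem_mul hx hy)

theorem envDeg_induction (V : ULieAlg.{u, v} K) {p : ℤ → V.Env → Prop} (one : p 0 1)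
    (gen_mul : ∀ i j (a : V.X.X i) x, x ∈ V.envDeg j → p j x → p (i + j) (V.gen i a * x))
    (zero : ∀ n, p n 0)
    (add : ∀ n x y, p n x → p n y → p n (x + y))
    (smul : ∀ n (c : K) x, p n x → p n (c • x))
    {n : ℤ} {x : V.Env} (hx : x ∈ V.envDeg n) : p n x := by
  induction hx using Submodule.span_induction with
  | mem x h =>
    obtain ⟨l, rfl, rfl⟩ := h
    induction l with
    | nil => simpa using one
    | cons q l ih =>
      simp only [List.map_cons, List.sum_cons, List.prod_cons]
      exact gen_mul _ _ _ _ (Submodule.subset_span ⟨l, rfl, rfl⟩) ih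
  | zero => exact zero n
  | add x y _ _ hx hy => exact add n x y hx hy
  | smul c x _ hx => exact smul n c x hx

/-- Auxiliary `2 × 2`-matrices used to construct the differential of the enveloping algebra. -/
noncomputable def dMat (V : ULieAlg.{u, v} K) (i : ℤ) :
    V.X.X i →ₗ[K] Matrix (Fin 2) (Fin 2) V.Env where
  toFun a := !![i.negOnePow • V.gen i a, V.gen (i - 1) ((V.X.d i (i - 1)).hom a); 0, V.gen i a]
  map_add' a b := by
    ext s t
    fin_cases s <;> fin_cases t <;> simp
  map_smul' c a := by
    ext s t
    fin_cases s <;> fin_cases t <;> simp [Units.smul_def, smul_comm]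

theorem negOnePow_smul_smul_self {M : Type*} [AddCommGroup M] (i : ℤ) (x : M) :
    i.negOnePow • i.negOnePow • x = x := by
  rw [smul_smul, ← Int.negOnePow_add, Int.negOnePow_even _ ⟨i, rfl⟩, one_smul]

theorem dMat_comm (V : ULieAlg.{u, v} K) {i j k : ℤ} (h : i + j = k) (a : V.X.X i)
    (b : V.X.X j) :
    V.dMat i a * V.dMat j b - (i * j).negOnePow • (V.dMat j b * V.dMat i a) =
      V.dMat k (V.bracket h a b) := by
  have h1 := V.gen_comm h a b
  have h2 := V.gen_comm (show (i - 1) + j = k - 1 by omega) ((V.X.d i (i - 1)).hom a) b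
  have h3 := V.gen_comm (show i + (j - 1) = k - 1 by omega) a ((V.X.d j (j - 1)).hom b)
  have h4 := V.d_bracket (i' := i - 1) (j' := j - 1) (k' := k - 1) h (by omega) (by omega)
    (by omega) a b
  have e1 : ((i - 1) * j).negOnePow = (i * j).negOnePow * j.negOnePow := by
    rw [← Int.negOnePow_sub]; congr 1; ring
  have e2 : (i * (j - 1)).negOnePow = (i * j).negOnePow * i.negOnePow := by
    rw [← Int.negOnePow_sub]; congr 1; ring
  have e3 : k.negOnePow = i.negOnePow * j.negOnePow := by
    rw [← Int.negOnePow_add, h]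
  ext s t
  fin_cases s <;> fin_cases t
  · simp [dMat, ← h1, e3]
    simp only [smul_sub, Units.smul_def, mul_smul_comm, smul_smul, Units.val_mul]
    congr 2; ring
  · simp only [dMat, LinearMap.coe_mk, AddHom.coe_mk, Matrix.sub_apply, Matrix.smul_apply,
      Matrix.mul_apply, Fin.sum_univ_two, h4, map_add]
    have : V.gen (k - 1) (i.negOnePow • V.bracket (show i + (j - 1) = k - 1 by omega) a
        ((V.X.d j (j - 1)).hom b)) = i.negOnePow • V.gen (k - 1) (V.bracket
        (show i + (j - 1) = k - 1 by omega) a ((V.X.d j (j - 1)).hom b)) := by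
      simp [Units.smul_def]
    simp [this, ← h2, ← h3, e1, e2]
    have hi : ∀ x : V.Env, i.negOnePow • ((i * j).negOnePow * i.negOnePow) • x =
        (i * j).negOnePow • x := fun x => by
      rw [mul_comm, ← smul_smul, negOnePow_smul_smul_self]
    simp only [smul_sub, hi]
    simp only [Units.smul_def, smul_mul_assoc, smul_smul, Units.val_mul]
    abel
  · simp [dMat]
  · simp [dMat, ← h1]

theorem dMat_one (V : ULieAlg.{u, v} K) : V.dMat 0 V.one = 1 := by
  have := V.d_one
  ext s t
  fin_cases s <;> fin_cases t <;> simp [dMat, V.gen_one]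
  exact (congrArg _ this).trans (map_zero _)

/-- Auxiliary algebra map used to construct the differential of the enveloping algebra. -/
noncomputable def envDMat (V : ULieAlg.{u, v} K) : V.Env →ₐ[K] Matrix (Fin 2) (Fin 2) V.Env :=
  V.envLift V.dMat V.dMat_comm V.dMat_one

/-- The differential of the enveloping algebra. It is the unique linear map that extends the
differential of `V` (`envD_gen`) and satisfies the graded Leibniz rule (`envD_mul`). -/
noncomputable def envD (V : ULieAlg.{u, v} K) : V.Env →ₗ[K] V.Env :=
  Matrix.entryLinearMap K V.Env 0 1 ∘ₗ V.envDMat.toLinearMap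

theorem envD_gen (V : ULieAlg.{u, v} K) {i i' : ℤ} (hi : i' + 1 = i) (a : V.X.X i) :
    V.envD (V.gen i a) = V.gen i' ((V.X.d i i').hom a) := by
  obtain rfl : i' = i - 1 := by omega
  simp [envD, envDMat, dMat]

theorem envD_one (V : ULieAlg.{u, v} K) : V.envD 1 = 0 := by
  simp [envD]

theorem envDMat_one_one (V : ULieAlg.{u, v} K) (x : V.Env) :
    V.envDMat x 1 1 = x := by
  induction x using V.env_induction with
  | one => simp
  | gen_mul i a x hx => simp [Matrix.mul_apply, Fin.sum_univ_two, hx, envDMat, dMat] at hx ⊢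
  | add x y hx hy => simp [hx, hy]
  | smul c x hx => simp [hx]

theorem envD_gen_mul (V : ULieAlg.{u, v} K) (i : ℤ) (a : V.X.X i) (x : V.Env) :
    V.envD (V.gen i a * x) =
      V.envD (V.gen i a) * x + i.negOnePow • (V.gen i a * V.envD x) := by
  have h := V.envDMat_one_one x
  simp [envD, Matrix.mul_apply, Fin.sum_univ_two, h]
  simp [envDMat, dMat, add_comm, Units.smul_def, _root_.mul_assoc]

/-- The graded Leibniz rule. -/
theorem envD_mul (V : ULieAlg.{u, v} K) {i : ℤ} {x : V.Env} (hx : x ∈ V.envDeg i) (y : V.Env) :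
    V.envD (x * y) = V.envD x * y + i.negOnePow • (x * V.envD y) := by
  refine V.envDeg_induction
    (p := fun i x => V.envD (x * y) = V.envD x * y + i.negOnePow • (x * V.envD y))
    ?_ ?_ ?_ ?_ ?_ hx
  · simp [envD_one]
  · intro i j a x _ h
    rw [_root_.mul_assoc, envD_gen_mul, h, V.envD_gen_mul i a x, Int.negOnePow_add]
    simp only [mul_add, add_mul, smul_add, Units.smul_def, smul_mul_assoc, mul_smul_comm,
      smul_smul, Units.val_mul, _root_.mul_assoc]
    abel
  · simp
  · intro n x x' h h'
    simp only [add_mul, map_add, h, h', smul_add]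
    abel
  · intro n c x h
    simp only [smul_mul_assoc, map_smul, h, smul_add, smul_comm c]

theorem envD_mem (V : ULieAlg.{u, v} K) {i j : ℤ} (h : j + 1 = i) {x : V.Env}
    (hx : x ∈ V.envDeg i) : V.envD x ∈ V.envDeg j := by
  obtain rfl : j = i - 1 := by omega
  clear h
  refine V.envDeg_induction (p := fun i x => V.envD x ∈ V.envDeg (i - 1)) ?_ ?_ ?_ ?_ ?_ hx
  · simp [envD_one]
  · intro i j a x hx h
    rw [envD_gen_mul, V.envD_gen (i' := i - 1) (by omega), Units.smul_def]
    exact add_mem (V.mul_mem_envDeg (by omega) (V.gen_mem_envDeg _ _) hx)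
      (zsmul_mem (V.mul_mem_envDeg (by omega) (V.gen_mem_envDeg _ _) h) _)
  · simp
  · intro n x y hx hy
    rw [map_add]
    exact add_mem hx hy
  · intro n c x hx
    rw [map_smul]
    exact Submodule.smul_mem _ _ hx

theorem envD_envD (V : ULieAlg.{u, v} K) (x : V.Env) : V.envD (V.envD x) = 0 := by
  induction x using V.env_induction with
  | one => simp [envD_one]
  | gen_mul i a x hx =>
    have hd : (V.X.d (i - 1) (i - 2)).hom ((V.X.d i (i - 1)).hom a) = 0 := by
      rw [← LinearMap.comp_apply, ← ModuleCat.hom_comp, V.X.d_comp_d]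
      rfl
    have e : (i - 1).negOnePow = -i.negOnePow := by
      rw [Int.negOnePow_sub]; simp
    rw [envD_gen_mul, V.envD_gen (i' := i - 1) (by omega), map_add, envD_gen_mul,
      V.envD_gen (i := i - 1) (i' := i - 2) (by omega), hd,
      Units.smul_def i.negOnePow, map_zsmul, envD_gen_mul, hx,
      V.envD_gen (i' := i - 1) (by omega), e]
    simp [Units.smul_def]
  | add x y hx hy => rw [map_add, map_add, hx, hy, add_zero]
  | smul c x hx => rw [map_smul, map_smul, hx, smul_zero]

/-- The chain complex underlying the unital universal enveloping algebra. -/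
noncomputable def envComplex (V : ULieAlg.{u, v} K) : ChainComplex (ModuleCat.{max u v} K) ℤ where
  X n := ModuleCat.of K (V.envDeg n)
  d i j := if h : j + 1 = i then
    ModuleCat.ofHom (V.envD.restrict fun _ hx => V.envD_mem h hx) else 0
  shape i j h := dif_neg h
  d_comp_d' i j k hij hjk := by
    change j + 1 = i at hij
    change k + 1 = j at hjk
    rw [dif_pos hij, dif_pos hjk]
    ext x
    exact congrArg Subtype.val (Subtype.ext (V.envD_envD x.1) : (⟨_, _⟩ : V.envDeg k) = 0)

theorem envComplex_d_apply (V : ULieAlg.{u, v} K) {i j : ℤ} (h : j + 1 = i) (x : V.envDeg i) :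
    ((V.envComplex.d i j).hom x : V.envDeg j) = ⟨V.envD x.1, V.envD_mem h x.2⟩ := by
  change ((if h : j + 1 = i then
    ModuleCat.ofHom (V.envD.restrict fun _ hx => V.envD_mem h hx) else 0 :
      ModuleCat.of K (V.envDeg i) ⟶ ModuleCat.of K (V.envDeg j))).hom x = _
  rw [dif_pos h]
  rfl

/-- The multiplication of the enveloping algebra on homogeneous components. -/
noncomputable def envMul (V : ULieAlg.{u, v} K) {i j k : ℤ} (h : i + j = k) :
    V.envDeg i →ₗ[K] V.envDeg j →ₗ[K] V.envDeg k :=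
  LinearMap.mk₂ K (fun x y => ⟨x.1 * y.1, V.mul_mem_envDeg h x.2 y.2⟩)
    (fun _ _ _ => Subtype.ext (add_mul _ _ _)) (fun _ _ _ => Subtype.ext (smul_mul_assoc _ _ _))
    (fun _ _ _ => Subtype.ext (mul_add _ _ _)) (fun _ _ _ => Subtype.ext (mul_smul_comm _ _ _))

/-- The unital universal enveloping algebra `φ_!(V) = T V / I` as a differential graded algebra. -/
noncomputable def envelope (V : ULieAlg.{u, v} K) : AsAlg.{u, max u v} K where
  X := V.envComplex
  mul h := V.envMul h
  one := (⟨1, V.one_mem_envDeg⟩ : V.envDeg 0)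
  d_one := (V.envComplex_d_apply (by norm_num) _).trans (Subtype.ext V.envD_one)
  d_mul {i j k i' j' k'} h hi hj hk a b := by
    refine (V.envComplex_d_apply hk _).trans ?_
    rw [show (V.envComplex.d i i').hom a = _ from V.envComplex_d_apply hi a,
      show (V.envComplex.d j j').hom b = _ from V.envComplex_d_apply hj b]
    exact Subtype.ext (V.envD_mul a.2 b.1)
  mul_assoc _ _ _ a b c := Subtype.ext (_root_.mul_assoc a.1 b.1 c.1)
  one_mul a := Subtype.ext (_root_.one_mul a.1)
  mul_one a := Subtype.ext (_root_.mul_one a.1)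

/-- The algebra map between enveloping algebras induced by a morphism `f : V ⟶ W`; it extends
`f` multiplicatively (`envMap_gen`). -/
noncomputable def envMap {V W : ULieAlg.{u, v} K} (f : V ⟶ W) : V.Env →ₐ[K] W.Env :=
  V.envLift (fun i => W.gen i ∘ₗ (f.hom.f i).hom)
    (fun h a b => by
      simp only [LinearMap.comp_apply, f.map_bracket]
      exact W.gen_comm h _ _) (by simp [f.map_one, W.gen_one])

@[simp] theorem envMap_gen {V W : ULieAlg.{u, v} K} (f : V ⟶ W) (i : ℤ) (a : V.X.X i) :
    envMap f (V.gen i a) = W.gen i ((f.hom.f i).hom a) := by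
  simp [envMap]

theorem envMap_mem {V W : ULieAlg.{u, v} K} (f : V ⟶ W) {n : ℤ} {x : V.Env}
    (hx : x ∈ V.envDeg n) : envMap f x ∈ W.envDeg n := by
  refine V.envDeg_induction (p := fun n x => envMap f x ∈ W.envDeg n) ?_ ?_ ?_ ?_ ?_ hx
  · simpa using W.one_mem_envDeg
  · intro i j a x _ h
    rw [map_mul, envMap_gen]
    exact W.mul_mem_envDeg rfl (W.gen_mem_envDeg _ _) h
  · simp
  · intro n x y hx hy
    rw [map_add]
    exact add_mem hx hy
  · intro n c x hx
    rw [map_smul]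
    exact Submodule.smul_mem _ _ hx

theorem envMap_envD {V W : ULieAlg.{u, v} K} (f : V ⟶ W) (x : V.Env) :
    W.envD (envMap f x) = envMap f (V.envD x) := by
  induction x using V.env_induction with
  | one => simp [envD_one]
  | gen_mul i a x hx =>
    have hf : (W.X.d i (i - 1)).hom ((f.hom.f i).hom a) =
        (f.hom.f (i - 1)).hom ((V.X.d i (i - 1)).hom a) := by
      rw [← LinearMap.comp_apply, ← ModuleCat.hom_comp, f.hom.comm]
      rfl
    rw [map_mul, envMap_gen, envD_gen_mul, hx, envD_gen_mul, map_add, map_mul,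
      V.envD_gen (i' := i - 1) (by omega), W.envD_gen (i' := i - 1) (by omega), envMap_gen, hf,
      Units.smul_def, Units.smul_def, map_zsmul, map_mul, envMap_gen]
  | add x y hx hy => simp only [map_add, hx, hy]
  | smul c x hx => simp only [map_smul, hx]

/-- The morphism of differential graded algebras `φ_!(f)`. -/
noncomputable def envelopeMap {V W : ULieAlg.{u, v} K} (f : V ⟶ W) : V.envelope ⟶ W.envelope where
  hom :=
    { f := fun n => ModuleCat.ofHom
        ((envMap f).toLinearMap.restrict fun _ hx => envMap_mem f hx :
          V.envDeg n →ₗ[K] W.envDeg n)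
      comm' := fun i j h => by
        ext x
        refine (W.envComplex_d_apply h _).trans (Subtype.ext ?_)
        refine (envMap_envD f x.1).trans ?_
        exact (congrArg (fun y : V.envDeg j => envMap f y.1) (V.envComplex_d_apply h x)).symm }
  map_mul _ a b := Subtype.ext (map_mul (envMap f) a.1 b.1)
  map_one := Subtype.ext (map_one (envMap f))

end ULieAlg

end

/-- The unital universal enveloping algebra functor `φ_! : Alg_uLie ⥤ Alg_As`. -/
noncomputable def phiShriek (K : Type u) [Field K] :
    ULieAlg.{u, v} K ⥤ AsAlg.{u, max u v} K where
  obj V := V.envelope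
  map f := ULieAlg.envelopeMap f
  map_id V := by
    have h : ULieAlg.envMap (𝟙 V) = AlgHom.id K V.Env :=
      V.env_hom_ext fun i a => ULieAlg.envMap_gen _ i a
    refine AsAlg.Hom.ext ?_
    ext n x
    exact Subtype.ext (DFunLike.congr_fun h x.1)
  map_comp {U V W} f g := by
    have h : ULieAlg.envMap (f ≫ g) = (ULieAlg.envMap g).comp (ULieAlg.envMap f) :=
      U.env_hom_ext fun i a => by
        rw [ULieAlg.envMap_gen, AlgHom.comp_apply, ULieAlg.envMap_gen, ULieAlg.envMap_gen]
        rfl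
    refine AsAlg.Hom.ext ?_
    ext n x
    exact Subtype.ext (DFunLike.congr_fun h x.1)

/-- A morphism of unital Lie algebras is a weak equivalence if the underlying chain map is a
quasi-isomorphism. -/
def ULieAlg.weakEquivalences (K : Type u) [Field K] : MorphismProperty (ULieAlg.{u, v} K) :=
  fun _ _ f => QuasiIso f.hom

/-- A morphism of differential graded algebras is a weak equivalence if the underlying chain map
is a quasi-isomorphism. -/
def AsAlg.weakEquivalences (K : Type u) [Field K] : MorphismProperty (AsAlg.{u, v} K) :=
  fun _ _ f => QuasiIso f.hom

/-!
The underlying complex of `φ_!(V)` does not depend on the bracket of `V`. A linear map out of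
`φ_!(V)` is a multilinear function `L` of words that respects the commutation relation and the
unit. In characteristic zero such an `L` is determined by its graded symmetrization, which can be
prescribed. Indeed, once `L` is known on words of length at most `n`, the relation asks for an `L`
on words of length `n + 1` that is fixed by affine operators `F ↦ s F + b`, where `s` runs over the
signed adjacent transpositions and `b` is given by `L` and the bracket. By the Jacobi identity `b`
is a `1`-cocycle of the symmetric group, hence a coboundary by averaging.

Consequently `φ_!` extends to chain maps and chain homotopies that merely respect the unit: apply
them to the letters of symmetrized words. Over a field the quasi-isomorphism `f` has a homotopy
inverse, and if the unit of `V'` is nonzero, the inverse and the homotopies can be chosen to respect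
the units; so `φ_!(f)` is a homotopy equivalence. If the unit of `V'` is zero, that of `V` is a
boundary `d x`, and multiplication by `x` and by `f x` contracts the two enveloping algebras.
-/

/-! ### Averaging over the symmetric group -/

section Symmetrizer

variable {R : Type*} [Ring R]

/-- The first `m` members of the sequence `s` satisfy the Coxeter relations of type `A_m`, i.e. the
relations between the adjacent transpositions of `m + 1` letters. -/
structure IsCoxeterA (s : ℕ → R) (m : ℕ) : Prop where
  sq : ∀ i, i < m → s i * s i = 1
  braid : ∀ i, i + 1 < m → s i * s (i + 1) * s i = s (i + 1) * s i * s (i + 1)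
  comm : ∀ i j, i + 2 ≤ j → j < m → s i * s j = s j * s i

theorem IsCoxeterA.mono {s : ℕ → R} {m n : ℕ} (h : IsCoxeterA s n) (hmn : m ≤ n) :
    IsCoxeterA s m where
  sq i hi := h.sq i (by omega)
  braid i hi := h.braid i (by omega)
  comm i j hij hj := h.comm i j hij (by omega)

theorem IsCoxeterA.op {s : ℕ → R} {m : ℕ} (h : IsCoxeterA s m) :
    IsCoxeterA (fun i => MulOpposite.op (s i)) m where
  sq i hi := by rw [← MulOpposite.op_mul, h.sq i hi, MulOpposite.op_one]
  braid i hi := by simp only [← MulOpposite.op_mul, ← mul_assoc, h.braid i hi]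
  comm i j hij hj := by simp only [← MulOpposite.op_mul, h.comm i j hij hj]

/-- The sum `1 + s_{m-1} + s_{m-1} s_{m-2} + ⋯ + s_{m-1} ⋯ s_0` of the minimal representatives of
the right cosets of `⟨s_0, …, s_{m-2}⟩` in `⟨s_0, …, s_{m-1}⟩`. -/
def cosetSum (s : ℕ → R) : ℕ → R
  | 0 => 1
  | m + 1 => 1 + s m * cosetSum s m

theorem commute_cosetSum {s : ℕ → R} {m : ℕ} {x : R} (h : ∀ i < m, Commute x (s i)) :
    Commute x (cosetSum s m) := by
  induction m with
  | zero => exact Commute.one_right x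
  | succ m ih =>
    exact (Commute.one_right x).add_right
      ((h m m.lt_succ_self).mul_right (ih fun i hi => h i (by omega)))

theorem IsCoxeterA.mul_cosetSum_mul {s : ℕ → R} {m : ℕ} (h : IsCoxeterA s (m + 1)) {e : R}
    (he : ∀ i < m, e * s i = e) {i : ℕ} (hi : i < m + 1) :
    e * cosetSum s (m + 1) * s i = e * cosetSum s (m + 1) := by
  induction m generalizing e i with
  | zero =>
    obtain rfl : i = 0 := by omega
    simp only [cosetSum, mul_one, mul_add, add_mul, mul_assoc, h.sq 0 (by omega)]
    abel
  | succ m ih =>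
    have expand : e * cosetSum s (m + 2) = e + e * s (m + 1) * cosetSum s (m + 1) := by
      rw [cosetSum, mul_add, mul_one, mul_assoc]
    rcases Nat.lt_or_ge i (m + 1) with hi' | hi'
    · have fixed : ∀ k < m, e * s (m + 1) * s k = e * s (m + 1) := fun k hk => by
        rw [mul_assoc, ← h.comm k (m + 1) (by omega) (by omega), ← mul_assoc, he k (by omega)]
      rw [expand, add_mul, he i hi', ih (h.mono (by omega)) fixed hi']
    · obtain rfl : i = m + 1 := by omega
      have commute : cosetSum s m * s (m + 1) = s (m + 1) * cosetSum s m :=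
        (commute_cosetSum fun k hk => (h.comm k (m + 1) (by omega) (by omega)).symm).eq.symm
      have absorb : e * s (m + 1) * s m * cosetSum s m * s (m + 1) =
          e * s (m + 1) * s m * cosetSum s m := by
        calc e * s (m + 1) * s m * cosetSum s m * s (m + 1)
            = e * (s (m + 1) * s m * s (m + 1)) * cosetSum s m := by
              simp only [mul_assoc, commute]
          _ = e * s m * s (m + 1) * s m * cosetSum s m := by
              rw [← h.braid m (by omega)]; simp only [mul_assoc]
          _ = e * s (m + 1) * s m * cosetSum s m := by rw [he m (by omega)]
      have expand' : e * cosetSum s (m + 2) =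
          e + e * s (m + 1) + e * s (m + 1) * s m * cosetSum s m := by
        rw [expand, cosetSum]; noncomm_ring
      rw [expand', add_mul, absorb, add_mul, mul_assoc e (s (m + 1)) (s (m + 1)),
        h.sq _ (by omega), mul_one, add_comm (e * s (m + 1)) e]

variable (K : Type*) [Field K] [Algebra K R]

/-- The average over the symmetric group generated by `s_0, …, s_{m-1}`, factored along the chain
of the subgroups generated by `s_0, …, s_{k-1}`. -/
noncomputable def symmetrizer (s : ℕ → R) : ℕ → R
  | 0 => 1
  | m + 1 => (m + 2 : K)⁻¹ • (symmetrizer s m * cosetSum s (m + 1))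

theorem IsCoxeterA.symmetrizer_mul {s : ℕ → R} {m : ℕ} (h : IsCoxeterA s m) {i : ℕ}
    (hi : i < m) : symmetrizer K s m * s i = symmetrizer K s m := by
  induction m generalizing i with
  | zero => omega
  | succ m ih =>
    rw [symmetrizer, smul_mul_assoc, h.mul_cosetSum_mul (fun k hk => ih (h.mono (by omega)) hk) hi]

section Action

variable {Y : Type*} [AddCommGroup Y] [Module K Y] [Module R Y] [IsScalarTower K R Y]

theorem cosetSum_smul_of_fixed {s : ℕ → R} {m : ℕ} {y : Y} (h : ∀ i < m, s i • y = y) :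
    cosetSum s m • y = (m + 1 : K) • y := by
  induction m with
  | zero => simp [cosetSum]
  | succ m ih =>
    rw [cosetSum, add_smul, mul_smul, ih fun i hi => h i (by omega), add_smul, one_smul, smul_add,
      one_smul, smul_comm, h m (by omega)]
    push_cast
    module

theorem symmetrizer_smul_of_fixed [CharZero K] {s : ℕ → R} {m : ℕ} {y : Y}
    (h : ∀ i < m, s i • y = y) : symmetrizer K s m • y = y := by
  induction m with
  | zero => simp [symmetrizer]
  | succ m ih =>
    have hm : (m + 2 : K) ≠ 0 := by exact_mod_cast (show m + 2 ≠ 0 by omega)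
    rw [symmetrizer, smul_assoc, mul_smul, cosetSum_smul_of_fixed K h,
      smul_comm (symmetrizer K s m),
      ih fun i hi => h i (by omega), smul_smul, Nat.cast_add_one, add_assoc,
      one_add_one_eq_two, inv_mul_cancel₀ hm, one_smul]

end Action

variable [CharZero K]

/-- The symmetrizer of the opposite ring is invariant on the other side, and two such one-sided
averages coincide. -/
theorem IsCoxeterA.mul_symmetrizer {s : ℕ → R} {m : ℕ} (h : IsCoxeterA s m) {i : ℕ}
    (hi : i < m) : s i * symmetrizer K s m = symmetrizer K s m := by
  obtain ⟨e, he⟩ := MulOpposite.op_surjective (symmetrizer K (fun i => MulOpposite.op (s i)) m)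
  have left_invariant : ∀ j < m, s j * e = e := fun j hj => by
    have := h.op.symmetrizer_mul K hj
    rwa [← he, ← MulOpposite.op_mul, MulOpposite.op_inj] at this
  have absorb : symmetrizer K s m * e = symmetrizer K s m := by
    have := symmetrizer_smul_of_fixed K (s := fun i => MulOpposite.op (s i)) (m := m)
      (y := MulOpposite.op (symmetrizer K s m)) fun j hj => by
        rw [smul_eq_mul, ← MulOpposite.op_mul, h.symmetrizer_mul K hj]
    rwa [← he, smul_eq_mul, ← MulOpposite.op_mul, MulOpposite.op_inj] at this
  have eq : symmetrizer K s m • e = e := symmetrizer_smul_of_fixed K left_invariant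
  rw [← absorb, ← smul_eq_mul (symmetrizer K s m), eq, left_invariant i hi]

end Symmetrizer

section SymmetrizerAction

variable {K : Type*} [Field K] {Y Y' : Type*} [AddCommGroup Y] [Module K Y] [AddCommGroup Y']
  [Module K Y']

theorem symmetrizer_apply_of_fixed [CharZero K] {s : ℕ → Module.End K Y} {m : ℕ} {y : Y}
    (h : ∀ i < m, s i y = y) : symmetrizer K s m y = y :=
  symmetrizer_smul_of_fixed (R := Module.End K Y) K h

theorem map_cosetSum (A : Y →ₗ[K] Y') {s : ℕ → Module.End K Y} {s' : ℕ → Module.End K Y'} {m : ℕ}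
    (h : ∀ i < m, ∀ y, A (s i y) = s' i (A y)) (y : Y) :
    A (cosetSum s m y) = cosetSum s' m (A y) := by
  induction m with
  | zero => simp [cosetSum]
  | succ m ih =>
    simp only [cosetSum, LinearMap.add_apply, Module.End.mul_apply, Module.End.one_apply, map_add,
      h m m.lt_succ_self, ih fun i hi => h i (by omega)]

theorem map_symmetrizer (A : Y →ₗ[K] Y') {s : ℕ → Module.End K Y} {s' : ℕ → Module.End K Y'}
    {m : ℕ} (h : ∀ i < m, ∀ y, A (s i y) = s' i (A y)) (y : Y) :
    A (symmetrizer K s m y) = symmetrizer K s' m (A y) := by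
  induction m generalizing y with
  | zero => simp [symmetrizer]
  | succ m ih =>
    simp only [symmetrizer, LinearMap.smul_apply, Module.End.mul_apply, map_smul,
      map_cosetSum A h, ih fun i hi => h i (by omega)]

theorem cosetSum_mem {s : ℕ → Module.End K Y} {m : ℕ} (p : Submodule K Y)
    (h : ∀ i < m, ∀ y ∈ p, s i y ∈ p) {y : Y} (hy : y ∈ p) : cosetSum s m y ∈ p := by
  induction m with
  | zero => simpa [cosetSum]
  | succ m ih => exact add_mem hy (h m m.lt_succ_self _ (ih fun i hi => h i (by omega)))

theorem symmetrizer_mem {s : ℕ → Module.End K Y} {m : ℕ} (p : Submodule K Y)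
    (h : ∀ i < m, ∀ y ∈ p, s i y ∈ p) {y : Y} (hy : y ∈ p) : symmetrizer K s m y ∈ p := by
  induction m generalizing y with
  | zero => simpa [symmetrizer]
  | succ m ih => exact p.smul_mem _ (ih (fun i hi => h i (by omega)) (cosetSum_mem p h hy))

/-- The sequence `b` extends to a `1`-cocycle of the symmetric group generated by
`s_0, …, s_{m-1}`, with values in `Y`. -/
structure IsCocycle (s : ℕ → Module.End K Y) (m : ℕ) (b : ℕ → Y) : Prop where
  sq : ∀ i < m, s i (b i) + b i = 0
  braid : ∀ i, i + 1 < m → s i (s (i + 1) (b i)) + s i (b (i + 1)) + b i =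
    s (i + 1) (s i (b (i + 1))) + s (i + 1) (b i) + b (i + 1)
  comm : ∀ i j, i + 2 ≤ j → j < m → s i (b j) + b i = s j (b i) + b j

/-- The affine operator `y ↦ s y + b`, homogenized to a linear operator on `Y × K`. -/
def affineEnd (s : Module.End K Y) (b : Y) : Module.End K (Y × K) :=
  (s.coprod (LinearMap.toSpanSingleton K Y b)).prod (LinearMap.snd K Y K)

@[simp] theorem affineEnd_apply (s : Module.End K Y) (b : Y) (z : Y × K) :
    affineEnd s b z = (s z.1 + z.2 • b, z.2) := rfl

theorem IsCocycle.isCoxeterA_affineEnd {s : ℕ → Module.End K Y} {m : ℕ} {b : ℕ → Y}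
    (hb : IsCocycle s m b) (hs : IsCoxeterA s m) :
    IsCoxeterA (fun i => affineEnd (s i) (b i)) m where
  sq i hi := LinearMap.ext fun z => Prod.ext (by
    have h := DFunLike.congr_fun (hs.sq i hi) z.1
    simp only [Module.End.mul_apply, Module.End.one_apply] at h
    simp [Module.End.mul_apply, h, add_assoc, ← smul_add, hb.sq i hi]) rfl
  braid i hi := LinearMap.ext fun z => Prod.ext (by
    have h := DFunLike.congr_fun (hs.braid i hi) z.1
    simp only [Module.End.mul_apply] at h
    simp [Module.End.mul_apply, h, add_assoc, ← smul_add, ← hb.braid i hi]) rfl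
  comm i j hij hj := LinearMap.ext fun z => Prod.ext (by
    have h := DFunLike.congr_fun (hs.comm i j hij hj) z.1
    simp only [Module.End.mul_apply] at h
    simp [Module.End.mul_apply, h, add_assoc, ← smul_add, hb.comm i j hij hj]) rfl

variable [CharZero K]

/-- The average of the affine orbit of the origin is a fixed point. -/
theorem IsCocycle.exists_coboundary {s : ℕ → Module.End K Y} {m : ℕ} {b : ℕ → Y}
    (hb : IsCocycle s m b) (hs : IsCoxeterA s m) {p : Submodule K Y}
    (hp : ∀ i < m, ∀ y ∈ p, s i y ∈ p) (hbp : ∀ i < m, b i ∈ p) :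
    ∃ y ∈ p, ∀ i < m, s i y + b i = y := by
  set A := fun i => affineEnd (s i) (b i)
  have fixed : ∀ i < m, A i (symmetrizer K A m (0, 1)) = symmetrizer K A m (0, 1) := fun i hi =>
    DFunLike.congr_fun ((hb.isCoxeterA_affineEnd hs).mul_symmetrizer K hi) (0, 1)
  have snd_eq : (symmetrizer K A m (0, 1)).2 = 1 := by
    have h := map_symmetrizer (LinearMap.snd K Y K) (s := A) (s' := 1) (m := m)
      (fun _ _ _ => rfl) (0, 1)
    exact h.trans (symmetrizer_apply_of_fixed fun _ _ => rfl)
  have mem : symmetrizer K A m (0, 1) ∈ p.prod (⊤ : Submodule K K) := by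
    refine symmetrizer_mem _ (fun i hi z hz => ?_) ⟨p.zero_mem, trivial⟩
    exact ⟨p.add_mem (hp i hi _ hz.1) (p.smul_mem _ (hbp i hi)), trivial⟩
  refine ⟨_, mem.1, fun i hi => ?_⟩
  have h := congrArg Prod.fst (fixed i hi)
  rwa [affineEnd_apply, snd_eq, one_smul] at h

theorem IsCocycle.exists_coboundary_of_symmetrizer {s : ℕ → Module.End K Y} {m : ℕ} {b : ℕ → Y}
    (hb : IsCocycle s m b) (hs : IsCoxeterA s m) {p : Submodule K Y}
    (hp : ∀ i < m, ∀ y ∈ p, s i y ∈ p) (hbp : ∀ i < m, b i ∈ p) {σ : Y} (hσ : σ ∈ p)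
    (hsσ : ∀ i < m, s i σ = σ) :
    ∃ y ∈ p, (∀ i < m, s i y + b i = y) ∧ symmetrizer K s m y = σ := by
  obtain ⟨y, hy, hyb⟩ := hb.exists_coboundary hs hp hbp
  have invariant : ∀ i < m, s i (symmetrizer K s m y) = symmetrizer K s m y := fun i hi =>
    DFunLike.congr_fun (hs.mul_symmetrizer K hi) y
  refine ⟨y - symmetrizer K s m y + σ,
    p.add_mem (p.sub_mem hy (symmetrizer_mem p hp hy)) hσ, fun i hi => ?_, ?_⟩
  · rw [map_add, map_sub, invariant i hi, hsσ i hi]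
    nth_rewrite 3 [← hyb i hi]
    abel
  · rw [map_add, map_sub, symmetrizer_apply_of_fixed invariant, symmetrizer_apply_of_fixed hsσ,
      sub_self, zero_add]

end SymmetrizerAction

/-! ### Graded symmetrization of functions of words -/

section Words

variable {A : ℤ → Type*}

/-- The exchange of the letters in positions `i` and `i + 1` of a word of homogeneous elements; it
does nothing to words that are too short. -/
def swapAt : ℕ → List (Sigma A) → List (Sigma A)
  | 0, a :: b :: l => b :: a :: l
  | i + 1, a :: l => a :: swapAt i l
  | _, l => l

/-- The Koszul sign of `swapAt`. -/
def swapSign : ℕ → List (Sigma A) → ℤˣ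
  | 0, a :: b :: _ => (a.1 * b.1).negOnePow
  | i + 1, _ :: l => swapSign i l
  | _, _ => 1

theorem swapAt_length_add (i : ℕ) (p l : List (Sigma A)) :
    swapAt (p.length + i) (p ++ l) = p ++ swapAt i l := by
  induction p with
  | nil => simp
  | cons c p ih => simp [Nat.add_right_comm p.length 1 i, swapAt, ih]

theorem swapSign_length_add (i : ℕ) (p l : List (Sigma A)) :
    swapSign (p.length + i) (p ++ l) = swapSign i l := by
  induction p with
  | nil => simp
  | cons c p ih => simp [Nat.add_right_comm p.length 1 i, swapSign, ih]

theorem swapAt_append (p q : List (Sigma A)) (a b : Sigma A) :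
    swapAt p.length (p ++ a :: b :: q) = p ++ b :: a :: q :=
  swapAt_length_add 0 p _

theorem swapSign_append (p q : List (Sigma A)) (a b : Sigma A) :
    swapSign p.length (p ++ a :: b :: q) = (a.1 * b.1).negOnePow :=
  swapSign_length_add 0 p _

@[simp] theorem length_swapAt (i : ℕ) (l : List (Sigma A)) : (swapAt i l).length = l.length := by
  induction i generalizing l with
  | zero => rcases l with _ | ⟨a, _ | ⟨_, l⟩⟩ <;> simp [swapAt]
  | succ i ih => rcases l with _ | ⟨a, l⟩ <;> simp [swapAt, ih]

@[simp] theorem swapAt_swapAt (i : ℕ) (l : List (Sigma A)) : swapAt i (swapAt i l) = l := by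
  induction i generalizing l with
  | zero => rcases l with _ | ⟨a, _ | ⟨b, l⟩⟩ <;> simp [swapAt]
  | succ i ih => rcases l with _ | ⟨a, l⟩ <;> simp [swapAt, ih]

theorem swapSign_mul_swapSign (i : ℕ) (l : List (Sigma A)) :
    swapSign i l * swapSign i (swapAt i l) = 1 := by
  induction i generalizing l with
  | zero =>
    rcases l with _ | ⟨a, _ | ⟨b, l⟩⟩
    · simp [swapAt, swapSign]
    · simp [swapAt, swapSign]
    · simp only [swapAt, swapSign]
      rw [mul_comm b.1, ← Int.negOnePow_add, Int.negOnePow_even _ ⟨_, rfl⟩]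
  | succ i ih => rcases l with _ | ⟨a, l⟩ <;> simp [swapAt, swapSign, ih]

theorem exists_eq_append_of_lt {i : ℕ} {l : List (Sigma A)} (h : i + 1 < l.length) :
    ∃ p a b q, p.length = i ∧ l = p ++ a :: b :: q := by
  induction i generalizing l with
  | zero =>
    rcases l with _ | ⟨a, _ | ⟨b, l⟩⟩
    · simp at h
    · simp at h
    · exact ⟨[], a, b, l, rfl, rfl⟩
  | succ i ih =>
    rcases l with _ | ⟨c, l⟩
    · simp at h
    · obtain ⟨p, a, b, q, hp, rfl⟩ := ih (l := l) (by simpa using h)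
      exact ⟨c :: p, a, b, q, by simp [hp], rfl⟩

theorem swapAt_comm {i j : ℕ} (h : i + 2 ≤ j) (l : List (Sigma A)) :
    swapAt i (swapAt j l) = swapAt j (swapAt i l) := by
  induction i generalizing j l with
  | zero =>
    obtain ⟨j, rfl⟩ := Nat.exists_eq_add_of_le' h
    rcases l with _ | ⟨a, _ | ⟨b, l⟩⟩ <;> simp [swapAt]
  | succ i ih =>
    obtain ⟨j, rfl⟩ := Nat.exists_eq_add_of_le' (show 1 ≤ j by omega)
    rcases l with _ | ⟨a, l⟩ <;> simp [swapAt, ih (show i + 2 ≤ j by omega)]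

theorem swapSign_swapAt {i j : ℕ} (h : i + 2 ≤ j) (l : List (Sigma A)) :
    swapSign i (swapAt j l) = swapSign i l ∧ swapSign j (swapAt i l) = swapSign j l := by
  induction i generalizing j l with
  | zero =>
    obtain ⟨j, rfl⟩ := Nat.exists_eq_add_of_le' h
    rcases l with _ | ⟨a, _ | ⟨b, l⟩⟩ <;> simp [swapAt, swapSign]
  | succ i ih =>
    obtain ⟨j, rfl⟩ := Nat.exists_eq_add_of_le' (show 1 ≤ j by omega)
    rcases l with _ | ⟨a, l⟩ <;> simp [swapAt, swapSign, ih (show i + 2 ≤ j by omega)]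

theorem swapAt_braid {i : ℕ} {l : List (Sigma A)} (h : i + 2 < l.length) :
    swapAt i (swapAt (i + 1) (swapAt i l)) = swapAt (i + 1) (swapAt i (swapAt (i + 1) l)) := by
  induction i generalizing l with
  | zero =>
    rcases l with _ | ⟨a, _ | ⟨b, _ | ⟨c, l⟩⟩⟩ <;> simp [swapAt] at h ⊢
  | succ i ih =>
    rcases l with _ | ⟨a, l⟩
    · simp at h
    · simpa [swapAt] using ih (by simp at h; omega)

theorem swapSign_braid {i : ℕ} {l : List (Sigma A)} (h : i + 2 < l.length) :
    swapSign i l * swapSign (i + 1) (swapAt i l) * swapSign i (swapAt (i + 1) (swapAt i l)) =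
      swapSign (i + 1) l * swapSign i (swapAt (i + 1) l) *
        swapSign (i + 1) (swapAt i (swapAt (i + 1) l)) := by
  induction i generalizing l with
  | zero =>
    rcases l with _ | ⟨a, _ | ⟨b, _ | ⟨c, l⟩⟩⟩
    · simp at h
    · simp at h
    · simp at h
    · simp only [swapAt, swapSign, zero_add]
      rw [mul_comm, mul_comm (Int.negOnePow _) (Int.negOnePow (a.1 * c.1)), mul_assoc]
  | succ i ih =>
    rcases l with _ | ⟨a, l⟩
    · simp at h
    · simpa [swapAt, swapSign] using ih (by simp at h; omega)

theorem apply_append_cons_of_central {M : Type*} {F : List (Sigma A) → M} {c : Sigma A}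
    (hF : ∀ p a q, F (p ++ c :: a :: q) = F (p ++ a :: c :: q)) (p q : List (Sigma A)) :
    F (p ++ c :: q) = F (p ++ q ++ [c]) := by
  induction q generalizing p with
  | nil => simp
  | cons a q ih => simpa [hF p a q] using ih (p ++ [a])

variable {K : Type*} [Field K] {M M' : Type*} [AddCommGroup M] [Module K M] [AddCommGroup M']
  [Module K M']

variable (K) in
/-- The signed exchange of the arguments in positions `i` and `i + 1` of a function of words. -/
def swapOp (i : ℕ) : Module.End K (List (Sigma A) → M) where
  toFun F l := swapSign i l • F (swapAt i l)
  map_add' F G := by ext l; exact smul_add _ _ _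
  map_smul' c F := by ext l; exact smul_comm _ _ _

@[simp] theorem swapOp_apply (i : ℕ) (F : List (Sigma A) → M) (l : List (Sigma A)) :
    swapOp K i F l = swapSign i l • F (swapAt i l) := rfl

variable (K) in
/-- The graded symmetrization of a function of words. -/
noncomputable def symFun (F : List (Sigma A) → M) (l : List (Sigma A)) : M :=
  symmetrizer K (swapOp K) (l.length - 1) F l

theorem symFun_add (F G : List (Sigma A) → M) : symFun K (F + G) = symFun K F + symFun K G := by
  ext l
  simp [symFun]

theorem symFun_sub (F G : List (Sigma A) → M) : symFun K (F - G) = symFun K F - symFun K G := by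
  ext l
  simp [symFun]

theorem symFun_comp (φ : M →ₗ[K] M') (F : List (Sigma A) → M) :
    symFun K (φ ∘ F) = φ ∘ symFun K F := by
  ext l
  refine (congrFun (map_symmetrizer (φ.compLeft (List (Sigma A))) (fun i _ G => ?_) F) l).symm
  ext l'
  simp [Units.smul_def]

/-- The words with `n` letters. -/
abbrev Word (A : ℤ → Type*) (n : ℕ) : Type _ := {l : List (Sigma A) // l.length = n}

variable (K) in
/-- The operator `swapOp` on functions of words with `n` letters. The relations between adjacent
transpositions only hold on words that are long enough. -/
def wordSwapOp (n i : ℕ) : Module.End K (Word A n → M) where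
  toFun F l := swapSign i l.1 • F ⟨swapAt i l.1, by rw [length_swapAt, l.2]⟩
  map_add' F G := by ext l; exact smul_add _ _ _
  map_smul' c F := by ext l; exact smul_comm _ _ _

theorem wordSwapOp_apply (n i : ℕ) (F : Word A n → M) (l : Word A n) :
    wordSwapOp K n i F l = swapSign i l.1 • F ⟨swapAt i l.1, by rw [length_swapAt, l.2]⟩ := rfl

theorem isCoxeterA_wordSwapOp (n : ℕ) :
    IsCoxeterA (wordSwapOp (A := A) (M := M) K n) (n - 1) where
  sq i _ := by
    ext F l
    simp [Module.End.mul_apply, wordSwapOp_apply, smul_smul, swapSign_mul_swapSign]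
  braid i hi := by
    ext F ⟨l, hl⟩
    simp only [Module.End.mul_apply, wordSwapOp_apply, smul_smul, ← mul_assoc]
    simp only [swapSign_braid (show i + 2 < l.length by omega),
      swapAt_braid (show i + 2 < l.length by omega)]
  comm i j hij _ := by
    ext F ⟨l, hl⟩
    simp only [Module.End.mul_apply, wordSwapOp_apply, smul_smul]
    simp only [swapAt_comm hij, (swapSign_swapAt hij l).1, (swapSign_swapAt hij l).2, mul_comm]

variable (K M) in
/-- The restriction of functions of words to words with `n` letters. -/
def restrictLength (A : ℤ → Type*) (n : ℕ) : (List (Sigma A) → M) →ₗ[K] (Word A n → M) :=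
  LinearMap.funLeft K M Subtype.val

theorem restrictLength_apply (n : ℕ) (F : List (Sigma A) → M) (l : Word A n) :
    restrictLength K M A n F l = F l.1 := rfl

theorem restrictLength_swapOp (n i : ℕ) (F : List (Sigma A) → M) :
    restrictLength K M A n (swapOp K i F) = wordSwapOp K n i (restrictLength K M A n F) := rfl

theorem symmetrizer_wordSwapOp {n : ℕ} (F : List (Sigma A) → M) :
    symmetrizer K (wordSwapOp K n) (n - 1) (restrictLength K M A n F) =
      restrictLength K M A n (symFun K F) := by
  ext ⟨l, rfl⟩
  exact (congrFun (map_symmetrizer (restrictLength K M A l.length)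
    (fun i _ G => restrictLength_swapOp _ i G) F) ⟨l, rfl⟩).symm

theorem symFun_congr {F G : List (Sigma A) → M} {l : List (Sigma A)}
    (h : ∀ l' : List (Sigma A), l'.length = l.length → F l' = G l') :
    symFun K F l = symFun K G l := by
  have hr : restrictLength K M A l.length F = restrictLength K M A l.length G :=
    funext fun l' => h l'.1 l'.2
  have hs := (symmetrizer_wordSwapOp F).symm.trans (hr ▸ symmetrizer_wordSwapOp G)
  exact congrFun hs ⟨l, rfl⟩

/-- Graded symmetric functions of words. -/
def IsSymmFun (F : List (Sigma A) → M) : Prop :=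
  ∀ p a b q, F (p ++ a :: b :: q) = (a.1 * b.1).negOnePow • F (p ++ b :: a :: q)

theorem isSymmFun_symFun [CharZero K] (F : List (Sigma A) → M) : IsSymmFun (symFun K F) := by
  intro p a b q
  let n := p.length + q.length + 2
  have invariant : wordSwapOp K n p.length (restrictLength K M A n (symFun K F)) =
      restrictLength K M A n (symFun K F) := by
    rw [← symmetrizer_wordSwapOp, ← Module.End.mul_apply,
      (isCoxeterA_wordSwapOp n).mul_symmetrizer K (by omega)]
  have h := congrFun invariant ⟨p ++ a :: b :: q, by simp [n]; omega⟩
  simp only [wordSwapOp_apply, restrictLength_apply, swapAt_append, swapSign_append] at h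
  exact h.symm

theorem symFun_apply_of_fixed [CharZero K] {F : List (Sigma A) → M} {n : ℕ}
    (hF : ∀ l : List (Sigma A), l.length = n → ∀ i < n - 1, swapSign i l • F (swapAt i l) = F l)
    {l : List (Sigma A)} (hl : l.length = n) : symFun K F l = F l := by
  have h := symmetrizer_apply_of_fixed (K := K) (s := wordSwapOp K n) (m := n - 1)
    (y := restrictLength K M A n F) fun i hi => funext fun l' => hF l'.1 l'.2 i hi
  rw [symmetrizer_wordSwapOp] at h
  exact congrFun h ⟨l, hl⟩

section AppendSingleton

variable {F : List (Sigma A) → M} {c : Sigma A}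

theorem cosetSum_swapOp_apply_append (hc : c.1 = 0)
    (hF : ∀ p a q, F (p ++ c :: a :: q) = F (p ++ a :: c :: q)) {k : ℕ} {p : List (Sigma A)}
    (hp : p.length = k) (q : List (Sigma A)) :
    cosetSum (swapOp K) k F (p ++ c :: q) = (k + 1 : K) • F (p ++ c :: q) := by
  induction k generalizing p q with
  | zero => simp [cosetSum]
  | succ k ih =>
    obtain ⟨p, a, rfl⟩ := List.eq_nil_or_concat' p |>.resolve_left (by rintro rfl; simp at hp)
    obtain rfl : p.length = k := by simpa using hp
    simp only [cosetSum, LinearMap.add_apply, Module.End.one_apply, Pi.add_apply,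
      Module.End.mul_apply, swapOp_apply, List.append_assoc, List.cons_append, List.nil_append,
      swapAt_append, swapSign_append, hc, mul_zero, Int.negOnePow_zero, one_smul]
    rw [ih rfl, hF, Nat.cast_succ, add_smul (_ + 1 : K), one_smul, add_comm]

theorem swapAt_append_of_lt {i : ℕ} {l : List (Sigma A)} (h : i + 1 < l.length)
    (q : List (Sigma A)) :
    swapAt i (l ++ q) = swapAt i l ++ q ∧ swapSign i (l ++ q) = swapSign i l := by
  obtain ⟨p, a, b, r, rfl, rfl⟩ := exists_eq_append_of_lt h
  simp only [List.append_assoc, List.cons_append, swapAt_append, swapSign_append, and_self]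

theorem symFun_append_singleton [CharZero K] (hc : c.1 = 0)
    (hF : ∀ p a q, F (p ++ c :: a :: q) = F (p ++ a :: c :: q)) (l : List (Sigma A)) :
    symFun K F (l ++ [c]) = symFun K (fun l => F (l ++ [c])) l := by
  obtain hl | ⟨m, hl⟩ : l.length = 0 ∨ ∃ m, l.length = m + 1 := by cases l <;> simp
  · simp [symFun, symmetrizer, List.length_eq_zero_iff.1 hl]
  let appendC : (List (Sigma A) → M) →ₗ[K] (Word A (m + 1) → M) :=
    LinearMap.funLeft K M fun l => l.1 ++ [c]
  have appendC_swapOp (i : ℕ) (hi : i < m) (G : List (Sigma A) → M) :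
      appendC (swapOp K i G) = wordSwapOp K (m + 1) i (appendC G) := by
    ext ⟨l, hl⟩
    have h := swapAt_append_of_lt (show i + 1 < l.length by omega) [c]
    simp [appendC, LinearMap.funLeft_apply, wordSwapOp_apply, h.1, h.2]
  have appendC_cosetSum : appendC (cosetSum (swapOp K) (m + 1) F) =
      (m + 2 : K) • restrictLength K M A (m + 1) fun l => F (l ++ [c]) := by
    ext ⟨l, hl⟩
    refine (cosetSum_swapOp_apply_append hc hF hl []).trans ?_
    push_cast
    rw [add_assoc, one_add_one_eq_two]
    rfl
  have hm : (m + 2 : K) ≠ 0 := by exact_mod_cast (m + 1).succ_ne_zero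
  have h := map_symmetrizer appendC appendC_swapOp (cosetSum (swapOp K) (m + 1) F)
  have hs : symmetrizer K (wordSwapOp K (m + 1)) m (restrictLength K M A _ fun l => F (l ++ [c])) =
      _ := symmetrizer_wordSwapOp _
  rw [appendC_cosetSum, map_smul, hs] at h
  have h' := congrArg ((m + 2 : K)⁻¹ • ·) (congrFun h ⟨l, hl⟩)
  simp only [Pi.smul_apply, inv_smul_smul₀ hm] at h'
  refine Eq.trans ?_ h'
  simp only [symFun, List.length_append, hl, List.length_singleton, Nat.add_sub_cancel]
  rfl

end AppendSingleton

end Words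

section MapWord

variable {A A' : ℤ → Type*}

/-- Apply a family of maps to each letter of a word. -/
def mapWord (g : ∀ i, A i → A' i) (l : List (Sigma A)) : List (Sigma A') :=
  l.map fun a => ⟨a.1, g a.1 a.2⟩

@[simp] theorem length_mapWord (g : ∀ i, A i → A' i) (l : List (Sigma A)) :
    (mapWord g l).length = l.length := by
  simp [mapWord]

theorem swapAt_mapWord (g : ∀ i, A i → A' i) (i : ℕ) (l : List (Sigma A)) :
    swapAt i (mapWord g l) = mapWord g (swapAt i l) ∧
      swapSign i (mapWord g l) = swapSign i l := by
  induction i generalizing l with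
  | zero => rcases l with _ | ⟨a, _ | ⟨b, l⟩⟩ <;> exact ⟨rfl, rfl⟩
  | succ i ih =>
    rcases l with _ | ⟨a, l⟩
    · exact ⟨rfl, rfl⟩
    · exact ⟨congrArg (List.cons _) (ih l).1, (ih l).2⟩

variable {K : Type*} [Field K] {M : Type*} [AddCommGroup M] [Module K M]

theorem symFun_comp_mapWord (g : ∀ i, A i → A' i) (F : List (Sigma A') → M) :
    symFun K (F ∘ mapWord g) = symFun K F ∘ mapWord g := by
  ext l
  rw [Function.comp_apply, symFun, symFun, length_mapWord]
  refine (congrFun (map_symmetrizer (LinearMap.funLeft K M (mapWord g)) (fun i _ G => ?_) F) l).symm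
  ext l'
  simp [LinearMap.funLeft_apply, swapAt_mapWord]

end MapWord

section Derivation

variable {A : ℤ → Type*} {K : Type*} [Field K] {M M' : Type*} [AddCommGroup M] [Module K M]
  [AddCommGroup M'] [Module K M'] (d : ∀ i, A i → A (i - 1))

/-- The transpose of the derivation on words that extends a map `d` of degree `-1` on letters. -/
def derivFun : (List (Sigma A) → M) → List (Sigma A) → M
  | _, [] => 0
  | F, a :: l => F (⟨a.1 - 1, d a.1 a.2⟩ :: l) + a.1.negOnePow • derivFun (fun l => F (a :: l)) l

theorem derivFun_cons (F : List (Sigma A) → M) (a : Sigma A) (l : List (Sigma A)) :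
    derivFun d F (a :: l) =
      F (⟨a.1 - 1, d a.1 a.2⟩ :: l) + a.1.negOnePow • derivFun d (fun l => F (a :: l)) l := rfl

theorem derivFun_add (F G : List (Sigma A) → M) :
    derivFun d (F + G) = derivFun d F + derivFun d G := by
  ext l
  induction l generalizing F G with
  | nil => simp [derivFun]
  | cons a l ih =>
    have := ih (fun l => F (a :: l)) (fun l => G (a :: l))
    simp only [Pi.add_apply] at this
    rw [Pi.add_apply, derivFun_cons, derivFun_cons, derivFun_cons, add_add_add_comm, ← smul_add,
      ← this]
    rfl

theorem derivFun_comp (φ : M →ₗ[K] M') (F : List (Sigma A) → M) :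
    derivFun d (φ ∘ F) = φ ∘ derivFun d F := by
  ext l
  induction l generalizing F with
  | nil => simp [derivFun]
  | cons a l ih =>
    simp only [Function.comp_apply, derivFun_cons, map_add, Units.smul_def, map_zsmul]
    exact congrArg (fun x => _ + (_ : ℤ) • x) (ih fun l => F (a :: l))

theorem derivFun_units_smul (s : ℤˣ) (F : List (Sigma A) → M) (l : List (Sigma A)) :
    derivFun d (fun l => s • F l) l = s • derivFun d F l := by
  induction l generalizing F with
  | nil => simp [derivFun]
  | cons a l ih => rw [derivFun_cons, derivFun_cons, ih, smul_add, smul_comm s]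

theorem derivFun_congr {F G : List (Sigma A) → M} {l : List (Sigma A)}
    (h : ∀ l' : List (Sigma A), l'.length = l.length → F l' = G l') :
    derivFun d F l = derivFun d G l := by
  induction l generalizing F G with
  | nil => rfl
  | cons a l ih =>
    rw [derivFun_cons, derivFun_cons, h _ (by simp), ih fun l' hl' => h _ (by simp [hl'])]

theorem derivFun_swapAt (i : ℕ) (F : List (Sigma A) → M) (l : List (Sigma A)) :
    derivFun d (fun l => swapSign i l • F (swapAt i l)) l =
      swapSign i l • derivFun d F (swapAt i l) := by
  induction i generalizing F l with
  | zero =>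
    rcases l with _ | ⟨a, _ | ⟨b, l⟩⟩
    · simp [derivFun, swapAt]
    · simp [derivFun, swapAt, swapSign]
    · have sign_d_left : ((a.1 - 1) * b.1).negOnePow = (a.1 * b.1).negOnePow * b.1.negOnePow := by
        rw [← Int.negOnePow_sub]; congr 1; ring
      have sign_d_right : (a.1 * (b.1 - 1)).negOnePow = (a.1 * b.1).negOnePow * a.1.negOnePow := by
        rw [← Int.negOnePow_sub]; congr 1; ring
      simp only [derivFun_cons, swapAt, swapSign, derivFun_units_smul, sign_d_left, sign_d_right,
        smul_add, smul_smul]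
      have sign_left : a.1.negOnePow * ((a.1 * b.1).negOnePow * a.1.negOnePow) =
          (a.1 * b.1).negOnePow := by
        rw [mul_comm, mul_assoc, Int.units_mul_self, mul_one]
      have sign_right : a.1.negOnePow * (b.1.negOnePow * (a.1 * b.1).negOnePow) =
          (a.1 * b.1).negOnePow * (b.1.negOnePow * a.1.negOnePow) := by
        rw [mul_comm, mul_comm b.1.negOnePow, mul_assoc]
      rw [sign_left, sign_right]
      abel
  | succ i ih =>
    rcases l with _ | ⟨a, l⟩
    · simp [derivFun, swapAt]
    · simp only [derivFun_cons, swapAt, swapSign, smul_add]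
      rw [ih fun l => F (a :: l), smul_comm]

theorem symFun_derivFun (F : List (Sigma A) → M) :
    symFun K (derivFun d F) = derivFun d (symFun K F) := by
  let B : Module.End K (List (Sigma A) → M) :=
    { toFun := derivFun d
      map_add' := derivFun_add d
      map_smul' := fun c F => derivFun_comp d (LinearMap.lsmul K M c) F }
  ext l
  have h : B (symmetrizer K (swapOp K) (l.length - 1) F) =
      symmetrizer K (swapOp K) (l.length - 1) (B F) :=
    map_symmetrizer B (fun i _ G => funext (derivFun_swapAt d i G)) F
  refine (congrFun h l).symm.trans (derivFun_congr d fun l' hl' => ?_)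
  rw [symFun, hl']

end Derivation

section Multilinear

variable {A : ℤ → Type*}

/-- The degree of a word of homogeneous elements. -/
def wordDeg (l : List (Sigma A)) : ℤ := (l.map Sigma.fst).sum

theorem wordDeg_swapAt (i : ℕ) (l : List (Sigma A)) : wordDeg (swapAt i l) = wordDeg l := by
  induction i generalizing l with
  | zero =>
    rcases l with _ | ⟨a, _ | ⟨b, l⟩⟩
    · rfl
    · rfl
    · simp [swapAt, wordDeg, add_left_comm]
  | succ i ih =>
    rcases l with _ | ⟨a, l⟩
    · rfl
    · simpa [swapAt, wordDeg] using ih l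

theorem exists_swapAt_append (i : ℕ) (p q : List (Sigma A)) (k : ℤ) :
    ∃ p' q' s, ∀ x : A k, swapAt i (p ++ ⟨k, x⟩ :: q) = p' ++ ⟨k, x⟩ :: q' ∧
      swapSign i (p ++ ⟨k, x⟩ :: q) = s := by
  induction i generalizing p with
  | zero =>
    rcases p with _ | ⟨a, _ | ⟨b, p⟩⟩
    · rcases q with _ | ⟨c, q⟩
      · exact ⟨[], [], 1, fun x => ⟨rfl, rfl⟩⟩
      · exact ⟨[c], q, (k * c.1).negOnePow, fun x => ⟨rfl, rfl⟩⟩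
    · exact ⟨[], a :: q, (a.1 * k).negOnePow, fun x => ⟨rfl, rfl⟩⟩
    · exact ⟨b :: a :: p, q, _, fun x => ⟨rfl, rfl⟩⟩
  | succ i ih =>
    rcases p with _ | ⟨a, p⟩
    · exact ⟨[], swapAt i q, swapSign i q, fun x => ⟨rfl, rfl⟩⟩
    · obtain ⟨p', q', s, h⟩ := ih p
      exact ⟨a :: p', q', s, fun x => ⟨by simp [swapAt, (h x).1], by simp [swapSign, (h x).2]⟩⟩

variable {K : Type*} [Field K] [∀ i, AddCommGroup (A i)] [∀ i, Module K (A i)]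
  {M : Type*} [AddCommGroup M] [Module K M]

variable (A) in
/-- The functions of words of homogeneous elements that are linear in each letter and send words
of degree `n` to `D n`. -/
def multilinearFun (D : ℤ → Submodule K M) : Submodule K (List (Sigma A) → M) where
  carrier := {F | (∀ p q i, ∃ g : A i →ₗ[K] M, ∀ x, F (p ++ ⟨i, x⟩ :: q) = g x) ∧
    ∀ l, F l ∈ D (wordDeg l)}
  add_mem' {F G} hF hG := by
    refine ⟨fun p q i => ?_, fun l => add_mem (hF.2 l) (hG.2 l)⟩
    obtain ⟨f, hf⟩ := hF.1 p q i
    obtain ⟨g, hg⟩ := hG.1 p q i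
    exact ⟨f + g, fun x => by simp [hf, hg]⟩
  zero_mem' := ⟨fun p q i => ⟨0, fun _ => rfl⟩, fun l => zero_mem _⟩
  smul_mem' c F hF := by
    refine ⟨fun p q i => ?_, fun l => Submodule.smul_mem _ c (hF.2 l)⟩
    obtain ⟨f, hf⟩ := hF.1 p q i
    exact ⟨c • f, fun x => by simp [hf]⟩

variable {D : ℤ → Submodule K M} {F : List (Sigma A) → M}

theorem swapOp_mem_multilinearFun (hF : F ∈ multilinearFun A D) (i : ℕ) :
    swapOp K i F ∈ multilinearFun A D := by
  refine ⟨fun p q k => ?_, fun l => ?_⟩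
  · obtain ⟨p', q', s, h⟩ := exists_swapAt_append i p q k
    obtain ⟨g, hg⟩ := hF.1 p' q' k
    exact ⟨(s : ℤ) • g, fun x => by simp [h, hg, Units.smul_def]⟩
  · rw [swapOp_apply, Units.smul_def]
    exact zsmul_mem (wordDeg_swapAt i l ▸ hF.2 (swapAt i l)) _

theorem diagonal_mem_multilinearFun {F : ℕ → List (Sigma A) → M}
    (hF : ∀ n, F n ∈ multilinearFun A D) : (fun l => F l.length l) ∈ multilinearFun A D := by
  refine ⟨fun p q i => ?_, fun l => (hF _).2 l⟩
  obtain ⟨g, hg⟩ := (hF (p.length + (q.length + 1))).1 p q i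
  exact ⟨g, fun x => by simp [hg]⟩

theorem symFun_mem_multilinearFun (hF : F ∈ multilinearFun A D) :
    symFun K F ∈ multilinearFun A D :=
  diagonal_mem_multilinearFun fun n =>
    symmetrizer_mem (m := n - 1) _ (fun i _ _ hG => swapOp_mem_multilinearFun hG i) hF

theorem comp_append_mem_multilinearFun (hF : F ∈ multilinearFun A D) (r : List (Sigma A)) :
    (fun l => F (l ++ r)) ∈ multilinearFun A fun n => D (n + wordDeg r) := by
  refine ⟨fun p q i => by simpa using hF.1 p (q ++ r) i, fun l => ?_⟩
  simpa [wordDeg] using hF.2 (l ++ r)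

end Multilinear

/-! ### Linear maps out of the enveloping algebra -/

namespace ULieAlg

variable {K : Type u} [Field K] (V : ULieAlg.{u, v} K)

/-- Homogeneous elements of `V`. -/
abbrev Letter : Type v := Σ i : ℤ, V.X.X i

/-- The bracket of homogeneous elements. -/
def brk (a b : V.Letter) : V.Letter := ⟨a.1 + b.1, V.bracket rfl a.2 b.2⟩

theorem brk_eq {a b : V.Letter} {k : ℤ} (h : a.1 + b.1 = k) :
    V.brk a b = ⟨k, V.bracket h a.2 b.2⟩ := by
  subst h
  rfl

/-- The unit of `V` as a homogeneous element. -/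
def unit : V.Letter := ⟨0, V.one⟩

theorem brk_unit_left (a : V.Letter) : V.brk V.unit a = ⟨a.1, 0⟩ := by
  have h : V.bracket (zero_add a.1) V.one a.2 = 0 := by
    rw [V.antisymm, V.bracket_one, smul_zero, neg_zero]
  exact (V.brk_eq (a := V.unit) (zero_add a.1)).trans (congrArg (Sigma.mk a.1) h)

/-- The product in the enveloping algebra of the letters of a word. -/
noncomputable def word (l : List V.Letter) : V.Env := (l.map fun p => V.gen p.1 p.2).prod

@[simp] theorem word_nil : V.word [] = 1 := rfl

@[simp] theorem word_cons (a : V.Letter) (l : List V.Letter) :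
    V.word (a :: l) = V.gen a.1 a.2 * V.word l := by simp [word]

@[simp] theorem word_append (l m : List V.Letter) : V.word (l ++ m) = V.word l * V.word m := by
  simp [word]

section Relations

variable {M : Type*} [AddCommGroup M]

/-- Functions of words that respect the commutation relation of the enveloping algebra. -/
def IsLieFun (F : List V.Letter → M) : Prop :=
  ∀ p a b q, F (p ++ a :: b :: q) =
    (a.1 * b.1).negOnePow • F (p ++ b :: a :: q) + F (p ++ V.brk a b :: q)

/-- The condition `IsLieFun` on the words with at most `n` letters. -/
def IsLieUpTo (n : ℕ) (F : List V.Letter → M) : Prop :=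
  ∀ p a b q, p.length + q.length + 2 ≤ n → F (p ++ a :: b :: q) =
    (a.1 * b.1).negOnePow • F (p ++ b :: a :: q) + F (p ++ V.brk a b :: q)

/-- Functions of words that do not change when a letter equal to the unit is left out. -/
def IsUnitalFun {M : Type*} (F : List V.Letter → M) : Prop :=
  ∀ p q, F (p ++ V.unit :: q) = F (p ++ q)

variable {V}

theorem IsLieFun.comp [Module K M] {M' : Type*} [AddCommGroup M'] [Module K M']
    {F : List V.Letter → M} (hF : V.IsLieFun F) (φ : M →ₗ[K] M') : V.IsLieFun (φ ∘ F) := by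
  intro p a b q
  simp only [Function.comp_apply, hF p a b q, map_add, Units.smul_def, map_zsmul]

theorem IsLieFun.isLieUpTo {F : List V.Letter → M} (hF : V.IsLieFun F) (n : ℕ) :
    V.IsLieUpTo n F := fun p a b q _ => hF p a b q

theorem IsUnitalFun.apply_unit_cons_cons {M : Type*} {F : List V.Letter → M}
    (hF : V.IsUnitalFun F) (p : List V.Letter) (a : V.Letter) (q : List V.Letter) :
    F (p ++ V.unit :: a :: q) = F (p ++ a :: V.unit :: q) := by
  have h := hF (p ++ [a]) q
  simp only [List.append_assoc, List.cons_append, List.nil_append] at h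
  rw [h, hF]

variable (V)

theorem isLieFun_word : V.IsLieFun V.word := by
  intro p a b q
  have h := V.gen_comm (show a.1 + b.1 = a.1 + b.1 from rfl) a.2 b.2
  rw [sub_eq_iff_eq_add] at h
  simp only [word_append, word_cons, brk]
  rw [← _root_.mul_assoc (V.gen a.1 a.2), h]
  simp only [add_mul, mul_add, Units.smul_def, smul_mul_assoc, mul_smul_comm, _root_.mul_assoc]
  abel

theorem isUnitalFun_word : V.IsUnitalFun V.word := by
  intro p q
  simp [unit, V.gen_one]

theorem word_mem_multilinearFun : V.word ∈ multilinearFun (fun i => V.X.X i) V.envDeg :=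
  ⟨fun p q i => ⟨LinearMap.mulLeft K (V.word p) ∘ₗ LinearMap.mulRight K (V.word q) ∘ₗ V.gen i,
    fun x => by simp⟩, fun l => Submodule.subset_span ⟨l, rfl, rfl⟩⟩

end Relations

section Extension

variable {M : Type*} [AddCommGroup M] [Module K M]

theorem env_linearMap_ext {φ ψ : V.Env →ₗ[K] M} (h : φ ∘ V.word = ψ ∘ V.word) : φ = ψ := by
  have key (x : V.Env) : ∀ l, φ (V.word l * x) = ψ (V.word l * x) := by
    induction x using V.env_induction with
    | one => simpa using congrFun h
    | gen_mul i a x hx =>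
      intro l
      have h' := hx (l ++ [⟨i, a⟩])
      rwa [word_append, word_cons, word_nil, _root_.mul_one, _root_.mul_assoc] at h'
    | add x y hx hy => intro l; rw [mul_add, map_add, map_add, hx, hy]
    | smul c x hx => intro l; rw [mul_smul_comm, map_smul, map_smul, hx]
  ext x
  simpa using key x []

theorem map_mem_of_word {φ : V.Env →ₗ[K] M} {D : ℤ → Submodule K M}
    (h : ∀ l, φ (V.word l) ∈ D (wordDeg l)) {n : ℤ} {x : V.Env} (hx : x ∈ V.envDeg n) :
    φ x ∈ D n := by
  induction hx using Submodule.span_induction with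
  | mem x hx =>
    obtain ⟨l, rfl, rfl⟩ := hx
    exact h l
  | zero => simp
  | add x y _ _ hx hy => rw [map_add]; exact add_mem hx hy
  | smul c x _ hx => rw [map_smul]; exact Submodule.smul_mem _ _ hx

variable (M) in
/-- The functions of words that come from linear maps out of the enveloping algebra. -/
def envFun : Submodule K (List V.Letter → M) where
  carrier := {F | F ∈ multilinearFun (fun i => V.X.X i) (fun _ => (⊤ : Submodule K M)) ∧
    V.IsLieFun F ∧ V.IsUnitalFun F}
  zero_mem' := ⟨zero_mem _, fun _ _ _ _ => by simp, fun _ _ => rfl⟩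
  add_mem' {F G} hF hG := ⟨add_mem hF.1 hG.1, fun p a b q => by
      simp only [Pi.add_apply, hF.2.1 p a b q, hG.2.1 p a b q, smul_add]
      abel, fun p q => by simp only [Pi.add_apply, hF.2.2 p q, hG.2.2 p q]⟩
  smul_mem' r F hF := ⟨Submodule.smul_mem _ _ hF.1, fun p a b q => by
      simp only [Pi.smul_apply, hF.2.1 p a b q, smul_add, smul_comm r],
    fun p q => by simp only [Pi.smul_apply, hF.2.2 p q]⟩

variable (M) in
/-- The operator of appending a homogeneous element to the argument. -/
def appendOp (i : ℤ) : V.X.X i →ₗ[K] Module.End K (V.envFun M) where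
  toFun a :=
    { toFun := fun F => ⟨fun l => F.1 (l ++ [⟨i, a⟩]), comp_append_mem_multilinearFun F.2.1 _,
        fun p b c q => by simpa using F.2.2.1 p b c (q ++ [⟨i, a⟩]),
        fun p q => by simpa using F.2.2.2 p (q ++ [⟨i, a⟩])⟩
      map_add' := fun _ _ => rfl
      map_smul' := fun _ _ => rfl }
  map_add' a b := LinearMap.ext fun F => Subtype.ext <| funext fun l => by
    obtain ⟨g, hg⟩ := F.2.1.1 l [] i
    exact (hg _).trans ((map_add g a b).trans (congrArg₂ _ (hg a) (hg b)).symm)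
  map_smul' c a := LinearMap.ext fun F => Subtype.ext <| funext fun l => by
    obtain ⟨g, hg⟩ := F.2.1.1 l [] i
    exact (hg _).trans ((map_smul g c a).trans (congrArg _ (hg a)).symm)

theorem appendOp_apply {i : ℤ} (a : V.X.X i) (F : V.envFun M) (l : List V.Letter) :
    (V.appendOp M i a F).1 l = F.1 (l ++ [⟨i, a⟩]) := rfl

theorem appendOp_comm {i j k : ℤ} (h : i + j = k) (a : V.X.X i) (b : V.X.X j) :
    V.appendOp M i a * V.appendOp M j b -
        (i * j).negOnePow • (V.appendOp M j b * V.appendOp M i a) =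
      V.appendOp M k (V.bracket h a b) := by
  subst h
  refine LinearMap.ext fun F => Subtype.ext <| funext fun l => ?_
  have h := F.2.2.1 l ⟨i, a⟩ ⟨j, b⟩ []
  rw [← sub_eq_iff_eq_add'] at h
  simpa [appendOp_apply, Units.smul_def, brk] using h

theorem appendOp_one : V.appendOp M 0 V.one = 1 :=
  LinearMap.ext fun F => Subtype.ext <| funext fun l =>
    (F.2.2.2 l []).trans (congrArg F.1 (List.append_nil l))

variable (M) in
/-- The action of the enveloping algebra on functions of words. -/
noncomputable def envFunAction : V.Env →ₐ[K] Module.End K (V.envFun M) :=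
  V.envLift (B := Module.End K (V.envFun M)) (V.appendOp M) V.appendOp_comm V.appendOp_one

theorem envFunAction_word (F : V.envFun M) (l m : List V.Letter) :
    (V.envFunAction M (V.word l) F).1 m = F.1 (m ++ l) := by
  induction l generalizing m with
  | nil => simp
  | cons a l ih =>
    rw [word_cons, map_mul, Module.End.mul_apply, envFunAction, envLift_gen, appendOp_apply,
      ← envFunAction, ih]
    simp

theorem exists_comp_word_eq {D : ℤ → Submodule K M} {F : List V.Letter → M}
    (hF : F ∈ multilinearFun (fun i => V.X.X i) D) (hLie : V.IsLieFun F)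
    (hunit : V.IsUnitalFun F) :
    ∃ φ : V.Env →ₗ[K] M, φ ∘ V.word = F ∧ ∀ n, ∀ x ∈ V.envDeg n, φ x ∈ D n := by
  let F' : V.envFun M := ⟨F, ⟨hF.1, fun _ => trivial⟩, hLie, hunit⟩
  let φ : V.Env →ₗ[K] M := (LinearMap.proj ([] : List V.Letter) ∘ₗ (V.envFun M).subtype) ∘ₗ
    LinearMap.applyₗ F' ∘ₗ (V.envFunAction M).toLinearMap
  have hφ (l) : φ (V.word l) = F l := V.envFunAction_word F' l []
  exact ⟨φ, funext hφ, fun n x => V.map_mem_of_word fun l => hφ l ▸ hF.2 l⟩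

end Extension

end ULieAlg

/-! ### Symmetrization and the Poincaré–Birkhoff–Witt theorem -/

namespace ULieAlg

variable {K : Type u} [Field K] (V : ULieAlg.{u, v} K)

/-- Replace the letters in positions `i` and `i + 1` by their bracket; this does nothing to words
that are too short. -/
def brkAt : ℕ → List V.Letter → List V.Letter
  | 0, a :: b :: l => V.brk a b :: l
  | i + 1, a :: l => a :: brkAt i l
  | _, l => l

theorem brkAt_length_add (i : ℕ) (p l : List V.Letter) :
    V.brkAt (p.length + i) (p ++ l) = p ++ V.brkAt i l := by
  induction p with
  | nil => simp
  | cons c p ih => simp [Nat.add_right_comm p.length 1 i, brkAt, ih]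

theorem brkAt_append (p q : List V.Letter) (a b : V.Letter) :
    V.brkAt p.length (p ++ a :: b :: q) = p ++ V.brk a b :: q :=
  V.brkAt_length_add 0 p _

theorem wordDeg_brkAt (i : ℕ) (l : List V.Letter) : wordDeg (V.brkAt i l) = wordDeg l := by
  induction i generalizing l with
  | zero =>
    rcases l with _ | ⟨a, _ | ⟨b, l⟩⟩
    · rfl
    · rfl
    · simp [brkAt, wordDeg, brk, add_assoc]
  | succ i ih =>
    rcases l with _ | ⟨a, l⟩
    · rfl
    · simpa [brkAt, wordDeg] using ih l

theorem exists_brkAt_append (i : ℕ) (p q : List V.Letter) (k : ℤ) :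
    ∃ p' q' k', ∃ g : V.X.X k →ₗ[K] V.X.X k',
      ∀ x, V.brkAt i (p ++ ⟨k, x⟩ :: q) = p' ++ ⟨k', g x⟩ :: q' := by
  induction i generalizing p with
  | zero =>
    rcases p with _ | ⟨a, _ | ⟨b, p⟩⟩
    · rcases q with _ | ⟨c, q⟩
      · exact ⟨[], [], k, LinearMap.id, fun x => rfl⟩
      · exact ⟨[], q, k + c.1, (V.bracket rfl).flip c.2, fun x => rfl⟩
    · exact ⟨[], q, a.1 + k, V.bracket rfl a.2, fun x => rfl⟩
    · exact ⟨V.brk a b :: p, q, k, LinearMap.id, fun x => rfl⟩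
  | succ i ih =>
    rcases p with _ | ⟨a, p⟩
    · exact ⟨[], V.brkAt i q, k, LinearMap.id, fun x => rfl⟩
    · obtain ⟨p', q', k', g, h⟩ := ih p
      exact ⟨a :: p', q', k', g, fun x => by simp [brkAt, h x]⟩

variable {V} {M : Type*} [AddCommGroup M] [Module K M] {D : ℤ → Submodule K M}
  {L L' : List V.Letter → M} {n : ℕ}

theorem comp_brkAt_mem_multilinearFun (hL : L ∈ multilinearFun (fun i => V.X.X i) D) (i : ℕ) :
    L ∘ V.brkAt i ∈ multilinearFun (fun i => V.X.X i) D := by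
  refine ⟨fun p q k => ?_, fun l => V.wordDeg_brkAt i l ▸ hL.2 _⟩
  obtain ⟨p', q', k', g, h⟩ := V.exists_brkAt_append i p q k
  obtain ⟨f, hf⟩ := hL.1 p' q' k'
  exact ⟨f ∘ₗ g, fun x => by simp [h, hf]⟩

theorem brk_antisymm (hL : L ∈ multilinearFun (fun i => V.X.X i) D) (p q : List V.Letter)
    (a b : V.Letter) :
    (a.1 * b.1).negOnePow • L (p ++ V.brk b a :: q) + L (p ++ V.brk a b :: q) = 0 := by
  obtain ⟨g, hg⟩ := hL.1 p q (a.1 + b.1)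
  rw [V.brk_eq (a := b) (b := a) (k := a.1 + b.1) (add_comm _ _), brk, hg, hg,
    V.antisymm rfl a.2 b.2, map_neg]
  simp [Units.smul_def]

variable (V) in
theorem bracket_bracket (i j k : ℤ) (a : V.X.X i) (b : V.X.X j) (c : V.X.X k) :
    V.bracket (add_assoc i j k) (V.bracket rfl a b) c + (i * j).negOnePow •
        V.bracket (show j + (k + i) = i + (j + k) by ring) b (V.bracket (add_comm i k) a c) =
      V.bracket rfl a (V.bracket rfl b c) := by
  have h := V.jacobi (ij := i + j) (jk := j + k) (ki := k + i) rfl rfl rfl rfl a b c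
  have sign : ((i + j) * k).negOnePow = (i * k).negOnePow * (k * j).negOnePow := by
    rw [← Int.negOnePow_add]; congr 1; ring
  rw [V.antisymm _ (V.bracket rfl a b) c, V.antisymm _ a c, sign]
  rw [mul_comm j i] at h
  generalize (i * k).negOnePow = s at *
  generalize (i * j).negOnePow = t at *
  generalize (k * j).negOnePow = r at *
  simp only [map_neg, Units.smul_def, map_zsmul] at h ⊢
  rcases Int.units_eq_one_or s with rfl | rfl <;> rcases Int.units_eq_one_or t with rfl | rfl <;>
    rcases Int.units_eq_one_or r with rfl | rfl <;>
    simp only [Units.val_one, Units.val_neg, one_smul, neg_smul, mul_one, mul_neg,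
      neg_neg] at h ⊢ <;> grind

theorem brk_jacobi (hL : L ∈ multilinearFun (fun i => V.X.X i) D) (p q : List V.Letter)
    (a b c : V.Letter) :
    L (p ++ V.brk (V.brk a b) c :: q) +
        (a.1 * b.1).negOnePow • L (p ++ V.brk b (V.brk a c) :: q) =
      L (p ++ V.brk a (V.brk b c) :: q) := by
  obtain ⟨i, a⟩ := a
  obtain ⟨j, b⟩ := b
  obtain ⟨k, c⟩ := c
  obtain ⟨g, hg⟩ := hL.1 p q (i + (j + k))
  have brk_ab_c : V.brk (V.brk ⟨i, a⟩ ⟨j, b⟩) ⟨k, c⟩ = ⟨i + (j + k),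
      V.bracket (add_assoc i j k) (V.bracket rfl a b) c⟩ :=
    V.brk_eq (a := V.brk ⟨i, a⟩ ⟨j, b⟩) (b := ⟨k, c⟩) (add_assoc i j k)
  have brk_b_ac : V.brk ⟨j, b⟩ (V.brk ⟨i, a⟩ ⟨k, c⟩) = ⟨i + (j + k),
      V.bracket (show j + (k + i) = i + (j + k) by ring) b (V.bracket (add_comm i k) a c)⟩ := by
    rw [V.brk_eq (a := ⟨i, a⟩) (b := ⟨k, c⟩) (add_comm i k)]
    exact V.brk_eq (a := ⟨j, b⟩) (b := ⟨k + i, V.bracket (add_comm i k) a c⟩) _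
  have brk_a_bc : V.brk ⟨i, a⟩ (V.brk ⟨j, b⟩ ⟨k, c⟩) = ⟨i + (j + k),
      V.bracket rfl a (V.bracket rfl b c)⟩ := rfl
  rw [brk_ab_c, brk_b_ac, brk_a_bc, hg, hg, hg, ← V.bracket_bracket i j k a b c, Units.smul_def,
    Units.smul_def, ← map_zsmul, ← map_add]

theorem swapOp_comp_brkAt_self (hL : L ∈ multilinearFun (fun i => V.X.X i) D) {i : ℕ}
    {l : List V.Letter} (hi : i + 1 < l.length) :
    swapOp K i (L ∘ V.brkAt i) l + (L ∘ V.brkAt i) l = 0 := by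
  obtain ⟨p, a, b, q, rfl, rfl⟩ := exists_eq_append_of_lt hi
  simpa only [swapOp_apply, swapAt_append, swapSign_append, Function.comp_apply, brkAt_append]
    using brk_antisymm hL p q a b

theorem swapOp_comp_brkAt_comm (hLie : V.IsLieUpTo n L) {i j : ℕ} (hij : i + 2 ≤ j)
    {l : List V.Letter} (hj : j + 1 < l.length) (hl : l.length ≤ n + 1) :
    swapOp K i (L ∘ V.brkAt j) l + (L ∘ V.brkAt i) l =
      swapOp K j (L ∘ V.brkAt i) l + (L ∘ V.brkAt j) l := by
  obtain ⟨p, a, b, q, rfl, rfl⟩ := exists_eq_append_of_lt (i := i) (l := l) (by omega)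
  obtain ⟨k, rfl⟩ := Nat.exists_eq_add_of_le hij
  obtain ⟨q, c, d, r, rfl, rfl⟩ := exists_eq_append_of_lt (i := k) (l := q) (by simp at hj; omega)
  simp only [List.length_append, List.length_cons] at hl
  have hab := hLie p a b (q ++ V.brk c d :: r) (by simp; omega)
  have hcd := hLie (p ++ V.brk a b :: q) c d r (by simp; omega)
  simp only [List.append_assoc, List.cons_append] at hcd
  simp only [swapOp_apply, Function.comp_apply, Nat.add_assoc, Nat.add_comm 2,
    swapAt_append, swapSign_append, swapAt_length_add, swapSign_length_add, brkAt_append,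
    brkAt_length_add, swapAt, swapSign, brkAt]
  rw [hab, hcd]
  abel

theorem swapOp_comp_brkAt_braid (hL : L ∈ multilinearFun (fun i => V.X.X i) D)
    (hLie : V.IsLieUpTo n L) {i : ℕ} {l : List V.Letter} (hi : i + 2 < l.length)
    (hl : l.length ≤ n + 1) :
    swapOp K i (swapOp K (i + 1) (L ∘ V.brkAt i)) l + swapOp K i (L ∘ V.brkAt (i + 1)) l +
        (L ∘ V.brkAt i) l =
      swapOp K (i + 1) (swapOp K i (L ∘ V.brkAt (i + 1))) l +
        swapOp K (i + 1) (L ∘ V.brkAt i) l + (L ∘ V.brkAt (i + 1)) l := by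
  obtain ⟨p, a, b, q, rfl, rfl⟩ := exists_eq_append_of_lt (i := i) (l := l) (by omega)
  obtain ⟨c, q, rfl⟩ := List.exists_cons_of_ne_nil (l := q) (by rintro rfl; simp at hi)
  simp only [List.length_append, List.length_cons] at hl
  have s1 : ((V.brk a b).1 * c.1).negOnePow = (a.1 * c.1).negOnePow * (b.1 * c.1).negOnePow := by
    rw [← Int.negOnePow_add]; congr 1; simp [brk]; ring
  have s2 : (a.1 * (V.brk b c).1).negOnePow = (a.1 * b.1).negOnePow * (a.1 * c.1).negOnePow := by
    rw [← Int.negOnePow_add]; congr 1; simp [brk]; ring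
  have s3 : (b.1 * (V.brk a c).1).negOnePow = (a.1 * b.1).negOnePow * (b.1 * c.1).negOnePow := by
    rw [← Int.negOnePow_add]; congr 1; simp [brk]; ring
  have hs (x : M) : (a.1 * b.1).negOnePow • ((a.1 * b.1).negOnePow * (b.1 * c.1).negOnePow) • x =
      (b.1 * c.1).negOnePow • x := by
    rw [← smul_smul, negOnePow_smul_smul_self]
  simp only [swapOp_apply, Function.comp_apply, swapAt_append, swapSign_append, swapAt_length_add,
    swapSign_length_add, brkAt_append, brkAt_length_add, swapAt, swapSign, brkAt]
  rw [hLie p (V.brk a b) c q (by omega), hLie p b (V.brk a c) q (by omega),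
    hLie p a (V.brk b c) q (by omega), ← brk_jacobi hL p q a b c, s1, s2, s3, smul_add, hs,
    smul_smul, smul_smul, mul_comm (b.1 * c.1).negOnePow]
  abel

theorem isCocycle_comp_brkAt (hL : L ∈ multilinearFun (fun i => V.X.X i) D)
    (hLie : V.IsLieUpTo n L) :
    IsCocycle (wordSwapOp K (n + 1)) n
      fun i => restrictLength K M (fun i => V.X.X i) (n + 1) (L ∘ V.brkAt i) where
  sq i hi := funext fun l => swapOp_comp_brkAt_self hL (l := l.1) (by have := l.2; omega)
  braid i hi := funext fun l =>
    swapOp_comp_brkAt_braid hL hLie (l := l.1) (by have := l.2; omega) l.2.le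
  comm i j hij hj := funext fun l =>
    swapOp_comp_brkAt_comm hLie hij (l := l.1) (by have := l.2; omega) l.2.le

variable [CharZero K]

theorem IsLieUpTo.eq_of_symFun_eq (hL : V.IsLieUpTo n L) (hL' : V.IsLieUpTo n L')
    (h : ∀ l : List V.Letter, l.length ≤ n → symFun K L l = symFun K L' l) (l : List V.Letter)
    (hl : l.length ≤ n) : L l = L' l := by
  induction hk : l.length using Nat.strong_induction_on generalizing l with
  | _ k ih =>
    have fixed : ∀ l' : List V.Letter, l'.length = k → ∀ i < k - 1,
        swapSign i l' • (L - L') (swapAt i l') = (L - L') l' := by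
      intro l' hl' i hi
      obtain ⟨p, a, b, q, rfl, rfl⟩ := exists_eq_append_of_lt (i := i) (l := l') (by omega)
      simp only [List.length_append, List.length_cons] at hl'
      have hbrk := ih _ (by simp; omega) (p ++ V.brk a b :: q) (by simp; omega) rfl
      rw [swapAt_append, swapSign_append, Pi.sub_apply, Pi.sub_apply, hL p a b q (by omega),
        hL' p a b q (by omega), hbrk, smul_sub, add_sub_add_right_eq_sub]
    have hsym := symFun_apply_of_fixed (K := K) fixed hk
    rw [symFun_sub, Pi.sub_apply, h l hl, sub_self] at hsym
    exact sub_eq_zero.1 hsym.symm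

theorem IsLieFun.eq_of_symFun_eq (hL : V.IsLieFun L) (hL' : V.IsLieFun L')
    (h : symFun K L = symFun K L') : L = L' :=
  funext fun l => (hL.isLieUpTo l.length).eq_of_symFun_eq (hL'.isLieUpTo l.length)
    (fun l' _ => congrFun h l') l le_rfl

end ULieAlg

namespace ULieAlg

variable {K : Type u} [Field K] [CharZero K] {V : ULieAlg.{u, v} K} {M : Type*} [AddCommGroup M]
  [Module K M] {D : ℤ → Submodule K M} {F L σ : List V.Letter → M} {n : ℕ}

theorem IsLieUpTo.exists_succ (hσ : σ ∈ multilinearFun (fun i => V.X.X i) D) (hσs : IsSymmFun σ)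
    (hL : L ∈ multilinearFun (fun i => V.X.X i) D) (hLie : V.IsLieUpTo n L)
    (hLσ : ∀ l : List V.Letter, l.length ≤ n → symFun K L l = σ l) :
    ∃ L' ∈ multilinearFun (fun i => V.X.X i) D, V.IsLieUpTo (n + 1) L' ∧
      ∀ l : List V.Letter, l.length ≤ n + 1 → symFun K L' l = σ l := by
  let r := restrictLength K M (fun i => V.X.X i) (n + 1)
  have swap_mem : ∀ i < n, ∀ y ∈ (multilinearFun (fun i => V.X.X i) D).map r,
      wordSwapOp K (n + 1) i y ∈ (multilinearFun (fun i => V.X.X i) D).map r := by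
    rintro i - _ ⟨G, hG, rfl⟩
    exact ⟨_, swapOp_mem_multilinearFun hG i, restrictLength_swapOp _ i G⟩
  have swap_σ : ∀ i < n, wordSwapOp K (n + 1) i (r σ) = r σ := by
    refine fun i hi => funext fun ⟨l, hl⟩ => ?_
    obtain ⟨p, a, b, q, rfl, rfl⟩ := exists_eq_append_of_lt (i := i) (l := l) (by omega)
    simp only [r, wordSwapOp_apply, restrictLength_apply, swapAt_append, swapSign_append]
    exact (hσs p a b q).symm
  obtain ⟨_, ⟨L₁, hL₁, rfl⟩, fixed, sym⟩ :=
    (isCocycle_comp_brkAt hL hLie).exists_coboundary_of_symmetrizer (isCoxeterA_wordSwapOp (n + 1))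
      swap_mem (fun i _ => ⟨_, comp_brkAt_mem_multilinearFun hL i, rfl⟩) ⟨σ, hσ, rfl⟩ swap_σ
  refine ⟨fun l => (if l.length = n + 1 then L₁ else L) l,
    diagonal_mem_multilinearFun (F := fun k => if k = n + 1 then L₁ else L)
      fun k => by split_ifs <;> assumption, fun p a b q hpq => ?_, fun l hl => ?_⟩
  · rcases eq_or_lt_of_le hpq with h | h
    · have h₁ := congrFun (fixed p.length (by omega)) ⟨p ++ a :: b :: q, by simp; omega⟩
      simp only [Pi.add_apply, wordSwapOp_apply, restrictLength_apply, Function.comp_apply,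
        swapAt_append, swapSign_append, brkAt_append] at h₁
      simpa [r, restrictLength_apply, show p.length + (q.length + 1 + 1) = n + 1 by omega,
        show p.length + (q.length + 1) ≠ n + 1 by omega] using h₁.symm
    · simpa [show p.length + (q.length + 1 + 1) ≠ n + 1 by omega,
        show p.length + (q.length + 1) ≠ n + 1 by omega] using hLie p a b q (by omega)
  · rcases eq_or_lt_of_le hl with h | h
    · rw [symFun_congr (G := L₁) fun l' hl' => by simp [hl', h]]
      exact congrFun ((symmetrizer_wordSwapOp L₁).symm.trans sym) ⟨l, h⟩
    · rw [symFun_congr (G := L) fun l' hl' => by simp [hl', h.ne], hLσ l (by omega)]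

theorem exists_isLieUpTo (hσ : σ ∈ multilinearFun (fun i => V.X.X i) D) (hσs : IsSymmFun σ)
    (n : ℕ) : ∃ L ∈ multilinearFun (fun i => V.X.X i) D, V.IsLieUpTo n L ∧
      ∀ l : List V.Letter, l.length ≤ n → symFun K L l = σ l := by
  induction n with
  | zero =>
    refine ⟨σ, hσ, fun p a b q h => absurd h (by omega), fun l hl => ?_⟩
    exact symFun_apply_of_fixed (n := 0) (fun _ _ i hi => absurd hi (by omega)) (by omega)
  | succ n ih =>
    obtain ⟨L, hL, hLie, hLσ⟩ := ih
    exact hLie.exists_succ hσ hσs hL hLσ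

theorem exists_isLieFun_symFun_eq (hσ : σ ∈ multilinearFun (fun i => V.X.X i) D)
    (hσs : IsSymmFun σ) :
    ∃ L ∈ multilinearFun (fun i => V.X.X i) D, V.IsLieFun L ∧ symFun K L = σ := by
  choose S hS hLie hSσ using exists_isLieUpTo hσ hσs
  have stable {l : List V.Letter} {n : ℕ} (h : l.length ≤ n) : S l.length l = S n l :=
    (hLie l.length).eq_of_symFun_eq (fun p a b q hpq => hLie n p a b q (hpq.trans h))
      (fun l' hl' => by rw [hSσ _ l' hl', hSσ n l' (hl'.trans h)]) l le_rfl
  refine ⟨fun l => S l.length l, diagonal_mem_multilinearFun hS, fun p a b q => ?_, ?_⟩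
  · have h := hLie (p.length + q.length + 2) p a b q le_rfl
    rwa [← stable (l := p ++ a :: b :: q) (by simp; omega),
      ← stable (l := p ++ b :: a :: q) (by simp; omega),
      ← stable (l := p ++ V.brk a b :: q) (by simp; omega)] at h
  · ext l
    rw [symFun_congr (G := S l.length) fun l' hl' => by rw [hl'], hSσ _ l le_rfl]

theorem IsUnitalFun.isUnitalFun_symFun (hF : V.IsUnitalFun F) : V.IsUnitalFun (symFun K F) := by
  have central (p a q) :
      symFun K F (p ++ V.unit :: a :: q) = symFun K F (p ++ a :: V.unit :: q) := by
    simpa [unit] using isSymmFun_symFun (K := K) F p V.unit a q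
  intro p q
  rw [apply_append_cons_of_central central,
    symFun_append_singleton rfl hF.apply_unit_cons_cons]
  exact symFun_congr fun l _ => by simpa using hF l []

theorem IsLieFun.isUnitalFun (hLie : V.IsLieFun L)
    (hL : L ∈ multilinearFun (fun i => V.X.X i) D) (h : V.IsUnitalFun (symFun K L)) :
    V.IsUnitalFun L := by
  have central (p a q) : L (p ++ V.unit :: a :: q) = L (p ++ a :: V.unit :: q) := by
    obtain ⟨g, hg⟩ := hL.1 p q a.1
    have h := hLie p V.unit a q
    rw [V.brk_unit_left, hg, map_zero, add_zero] at h
    simpa [unit] using h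
  have append_unit : (fun l => L (l ++ [V.unit])) = L := by
    refine IsLieFun.eq_of_symFun_eq (K := K)
      (fun p a b q => by simpa using hLie p a b (q ++ [V.unit])) hLie (funext fun l => ?_)
    rw [← symFun_append_singleton rfl central, h l [], List.append_nil]
  exact fun p q => (apply_append_cons_of_central central p q).trans (congrFun append_unit _)

theorem exists_symFun_comp_word_eq (hF : F ∈ multilinearFun (fun i => V.X.X i) D)
    (hunit : V.IsUnitalFun F) :
    ∃ φ : V.Env →ₗ[K] M, symFun K (φ ∘ V.word) = symFun K F ∧
      ∀ n, ∀ x ∈ V.envDeg n, φ x ∈ D n := by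
  obtain ⟨L, hL, hLie, hLF⟩ :=
    exists_isLieFun_symFun_eq (symFun_mem_multilinearFun hF) (isSymmFun_symFun F)
  obtain ⟨φ, rfl, hφ⟩ := V.exists_comp_word_eq hL hLie
    (hLie.isUnitalFun hL (hLF ▸ hunit.isUnitalFun_symFun))
  exact ⟨φ, hLF, hφ⟩

theorem env_linearMap_ext_symFun {φ ψ : V.Env →ₗ[K] M}
    (h : symFun K (φ ∘ V.word) = symFun K (ψ ∘ V.word)) : φ = ψ :=
  V.env_linearMap_ext ((V.isLieFun_word.comp φ).eq_of_symFun_eq (V.isLieFun_word.comp ψ) h)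

end ULieAlg

/-! ### Functoriality for chain maps and homotopies that respect the unit -/

section MapWord

variable {A A' : ℤ → Type*} {K : Type*} [Field K] {M : Type*} [AddCommGroup M] [Module K M]

theorem wordDeg_mapWord (g : ∀ i, A i → A' i) (l : List (Sigma A)) :
    wordDeg (mapWord g l) = wordDeg l := by
  simp [wordDeg, mapWord, Function.comp_def]

theorem derivFun_comp_mapWord {d : ∀ i, A i → A (i - 1)} {d' : ∀ i, A' i → A' (i - 1)}
    {g : ∀ i, A i → A' i} (h : ∀ i a, d' i (g i a) = g (i - 1) (d i a))
    (F : List (Sigma A') → M) :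
    derivFun d (F ∘ mapWord g) = derivFun d' F ∘ mapWord g := by
  ext l
  induction l generalizing F with
  | nil => rfl
  | cons a l ih =>
    have hl := ih fun l => F (⟨a.1, g a.1 a.2⟩ :: l)
    simp only [Function.comp_def, mapWord, List.map_cons, derivFun_cons, h] at hl ⊢
    rw [hl]

theorem comp_mapWord_mem_multilinearFun [∀ i, AddCommGroup (A i)] [∀ i, Module K (A i)]
    [∀ i, AddCommGroup (A' i)] [∀ i, Module K (A' i)] (g : ∀ i, A i →ₗ[K] A' i)
    {D : ℤ → Submodule K M} {F : List (Sigma A') → M} (hF : F ∈ multilinearFun A' D) :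
    F ∘ mapWord (fun i => g i) ∈ multilinearFun A D := by
  refine ⟨fun p q i => ?_, fun l => wordDeg_mapWord (fun i => g i) l ▸ hF.2 _⟩
  obtain ⟨f, hf⟩ := hF.1 (mapWord (fun i => g i) p) (mapWord (fun i => g i) q) i
  exact ⟨f ∘ₗ g i, fun x => by simpa [mapWord] using hf (g i x)⟩

end MapWord

namespace ULieAlg

variable {K : Type u} [Field K] {U V W : ULieAlg.{u, v} K} {M : Type*} [AddCommGroup M] [Module K M]

variable (V) in
/-- The differential of `V` as a family of maps. -/
def dLetter (i : ℤ) (a : V.X.X i) : V.X.X (i - 1) := (V.X.d i (i - 1)).hom a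

theorem comp_envD_word (φ : V.Env →ₗ[K] M) :
    φ ∘ V.envD ∘ V.word = derivFun V.dLetter (φ ∘ V.word) := by
  ext l
  induction l generalizing φ with
  | nil => simp [derivFun, V.envD_one]
  | cons a l ih =>
    have hl := ih (φ ∘ₗ LinearMap.mulLeft K (V.gen a.1 a.2))
    simp only [Function.comp_def, LinearMap.comp_apply, LinearMap.mulLeft_apply] at hl ⊢
    rw [derivFun_cons, word_cons, envD_gen_mul, V.envD_gen (i' := a.1 - 1) (by omega), map_add,
      Units.smul_def, map_zsmul, hl]
    rfl

/-- A chain map applied to each letter of a word. -/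
abbrev wordMap (g : V.X ⟶ W.X) : List V.Letter → List W.Letter := mapWord fun i => (g.f i).hom

theorem dLetter_comm (g : V.X ⟶ W.X) (i : ℤ) (a : V.X.X i) :
    W.dLetter i ((g.f i).hom a) = (g.f (i - 1)).hom (V.dLetter i a) := by
  rw [dLetter, ← LinearMap.comp_apply, ← ModuleCat.hom_comp, g.comm]
  rfl

theorem isUnitalFun_comp_wordMap {g : V.X ⟶ W.X} (hg : (g.f 0).hom V.one = W.one)
    {N : Type*} {F : List W.Letter → N} (hF : W.IsUnitalFun F) :
    V.IsUnitalFun (F ∘ wordMap g) := by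
  intro p q
  simpa [wordMap, mapWord, unit, hg] using hF (wordMap g p) (wordMap g q)

section PointedMap

variable [CharZero K]

theorem exists_pointedMap (g : V.X ⟶ W.X) (hg : (g.f 0).hom V.one = W.one) :
    ∃ φ : V.Env →ₗ[K] W.Env, symFun K (φ ∘ V.word) = symFun K (W.word ∘ wordMap g) ∧
      ∀ n, ∀ x ∈ V.envDeg n, φ x ∈ W.envDeg n :=
  exists_symFun_comp_word_eq
    (comp_mapWord_mem_multilinearFun (fun i => (g.f i).hom) W.word_mem_multilinearFun)
    (isUnitalFun_comp_wordMap hg W.isUnitalFun_word)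

/-- The linear map between enveloping algebras that applies a unital chain map to the letters of the
symmetrized words. It does not depend on the brackets. -/
noncomputable def pointedMap (g : V.X ⟶ W.X) (hg : (g.f 0).hom V.one = W.one) :
    V.Env →ₗ[K] W.Env := (exists_pointedMap g hg).choose

theorem symFun_pointedMap (g : V.X ⟶ W.X) (hg) :
    symFun K (pointedMap g hg ∘ V.word) = symFun K (W.word ∘ wordMap g) :=
  (exists_pointedMap g hg).choose_spec.1

theorem pointedMap_mem (g : V.X ⟶ W.X) (hg) {n : ℤ} {x : V.Env} (hx : x ∈ V.envDeg n) :
    pointedMap g hg x ∈ W.envDeg n :=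
  (exists_pointedMap g hg).choose_spec.2 n x hx

theorem pointedMap_hom (f : V ⟶ W) : pointedMap f.hom f.map_one = (envMap f).toLinearMap := by
  refine env_linearMap_ext_symFun ((symFun_pointedMap _ _).trans (congrArg _ (funext fun l => ?_)))
  simp [word, wordMap, mapWord, map_list_prod, Function.comp_def]

theorem pointedMap_id : pointedMap (𝟙 V.X) rfl = LinearMap.id :=
  env_linearMap_ext_symFun <| (symFun_pointedMap _ _).trans <| congrArg _ <| funext fun l =>
    congrArg V.word (List.map_id l)

theorem pointedMap_comp (g : U.X ⟶ V.X) (hg) (g' : V.X ⟶ W.X) (hg') (hgg') :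
    pointedMap g' hg' ∘ₗ pointedMap g hg = pointedMap (g ≫ g') hgg' := by
  refine env_linearMap_ext_symFun ?_
  calc symFun K (pointedMap g' hg' ∘ pointedMap g hg ∘ U.word)
    _ = symFun K (pointedMap g' hg' ∘ V.word) ∘ wordMap g := by
      rw [symFun_comp, symFun_pointedMap, symFun_comp_mapWord, symFun_comp, Function.comp_assoc]
    _ = symFun K (W.word ∘ wordMap g' ∘ wordMap g) := by
      rw [symFun_pointedMap, ← symFun_comp_mapWord, Function.comp_assoc]
    _ = symFun K (W.word ∘ wordMap (g ≫ g')) := by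
      congr 2
      ext1 l
      simp [wordMap, mapWord]
    _ = symFun K (pointedMap (g ≫ g') hgg' ∘ U.word) := (symFun_pointedMap _ _).symm

theorem envD_pointedMap (g : V.X ⟶ W.X) (hg) :
    W.envD ∘ₗ pointedMap g hg = pointedMap g hg ∘ₗ V.envD := by
  refine env_linearMap_ext_symFun ?_
  calc symFun K (W.envD ∘ pointedMap g hg ∘ V.word)
    _ = symFun K (W.envD ∘ W.word) ∘ wordMap g := by
      rw [symFun_comp, symFun_pointedMap, symFun_comp_mapWord, symFun_comp, Function.comp_assoc]
    _ = symFun K (derivFun V.dLetter (W.word ∘ wordMap g)) := by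
      rw [derivFun_comp_mapWord (dLetter_comm g), symFun_comp_mapWord]
      exact congrArg (symFun K · ∘ _) (comp_envD_word LinearMap.id)
    _ = symFun K (pointedMap g hg ∘ V.envD ∘ V.word) := by
      rw [symFun_derivFun, ← symFun_pointedMap g hg, ← symFun_derivFun, comp_envD_word]

end PointedMap

end ULieAlg

section Homotopy

variable {K : Type u} [Field K] {C D : ChainComplex (ModuleCat.{v} K) ℤ} {φ ψ : C ⟶ D}

theorem homotopy_comm_apply (H : Homotopy φ ψ) {i j k : ℤ} (hi : j + 1 = i) (hk : k + 1 = j)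
    (x : C.X j) : (φ.f j).hom x =
      (D.d i j).hom ((H.hom j i).hom x) + (H.hom k j).hom ((C.d j k).hom x) + (ψ.f j).hom x := by
  rw [H.comm, dNext_eq _ (show (ComplexShape.down ℤ).Rel j k from hk),
    prevD_eq _ (show (ComplexShape.down ℤ).Rel i j from hi), add_comm ((C.d j k) ≫ _)]
  rfl

/-- A chain homotopy given by linear maps between the components. -/
def homotopyMk (h : ∀ i j, i + 1 = j → (C.X i →ₗ[K] D.X j))
    (comm : ∀ {i j k} (hi : j + 1 = i) (hk : k + 1 = j) (x : C.X j), (φ.f j).hom x =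
      (D.d i j).hom (h j i hi x) + h k j hk ((C.d j k).hom x) + (ψ.f j).hom x) :
    Homotopy φ ψ where
  hom i j := if hij : i + 1 = j then ModuleCat.ofHom (h i j hij) else 0
  zero _ _ hij := dif_neg hij
  comm j := by
    have hj : j - 1 + 1 = j := by omega
    rw [dNext_eq _ (show (ComplexShape.down ℤ).Rel j (j - 1) from hj),
      prevD_eq _ (show (ComplexShape.down ℤ).Rel (j + 1) j from rfl), dif_pos hj, dif_pos rfl,
      add_comm ((C.d j (j - 1)) ≫ _)]
    ext x
    exact comm rfl hj x

theorem homotopyMk_hom_apply (h : ∀ i j, i + 1 = j → (C.X i →ₗ[K] D.X j)) (comm) {i j : ℤ}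
    (hij : i + 1 = j) (x : C.X i) :
    ((homotopyMk (φ := φ) (ψ := ψ) h comm).hom i j).hom x = h i j hij x :=
  congrArg (fun g : C.X i ⟶ D.X j => g.hom x) (dif_pos hij)

end Homotopy

namespace ULieAlg

variable {K : Type u} [Field K] {U V W : ULieAlg.{u, v} K}

section HomotopyFun

variable {φ ψ : V.X ⟶ W.X} (H : Homotopy φ ψ)

/-- The homotopy between the words in `φ` and the words in `ψ` that is induced by a homotopy `H`
between `φ` and `ψ`: the signed sum of the words in which `φ` is applied to the letters to the left
of some letter, `H` to that letter, and `ψ` to the letters to its right. -/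
noncomputable def homotopyFun : List V.Letter → W.Env
  | [] => 0
  | a :: l => W.gen (a.1 + 1) ((H.hom a.1 (a.1 + 1)).hom a.2) * W.word (wordMap ψ l) +
      a.1.negOnePow • (W.gen a.1 ((φ.f a.1).hom a.2) * homotopyFun l)

theorem homotopyFun_cons (a : V.Letter) (l : List V.Letter) :
    homotopyFun H (a :: l) =
      W.gen (a.1 + 1) ((H.hom a.1 (a.1 + 1)).hom a.2) * W.word (wordMap ψ l) +
        a.1.negOnePow • (W.gen a.1 ((φ.f a.1).hom a.2) * homotopyFun H l) := rfl

theorem homotopyFun_mem_multilinearFun :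
    homotopyFun H ∈ multilinearFun (fun i => V.X.X i) fun n => W.envDeg (n + 1) := by
  have hw := comp_mapWord_mem_multilinearFun (fun i => (ψ.f i).hom) W.word_mem_multilinearFun
  refine ⟨fun p q i => ?_, fun l => ?_⟩
  · induction p with
    | nil =>
      exact ⟨LinearMap.mulRight K (W.word (wordMap ψ q)) ∘ₗ W.gen (i + 1) ∘ₗ
        (H.hom i (i + 1)).hom + (i.negOnePow : ℤ) •
          (LinearMap.mulRight K (homotopyFun H q) ∘ₗ W.gen i ∘ₗ (φ.f i).hom), fun x => rfl⟩
    | cons a p ih =>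
      obtain ⟨g, hg⟩ := hw.1 p q i
      obtain ⟨g', hg'⟩ := ih
      refine ⟨LinearMap.mulLeft K (W.gen _ ((H.hom a.1 (a.1 + 1)).hom a.2)) ∘ₗ g +
        (a.1.negOnePow : ℤ) • (LinearMap.mulLeft K (W.gen _ ((φ.f a.1).hom a.2)) ∘ₗ g'),
        fun x => ?_⟩
      simp only [Function.comp_apply] at hg
      rw [List.cons_append, homotopyFun_cons, hg, hg']
      rfl
  · induction l with
    | nil => exact zero_mem _
    | cons a l ih =>
      have hdeg : wordDeg (a :: l) = a.1 + wordDeg l := rfl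
      rw [homotopyFun_cons, hdeg, Units.smul_def]
      exact add_mem (W.mul_mem_envDeg (by ring) (W.gen_mem_envDeg _ _) (hw.2 l))
        (zsmul_mem (W.mul_mem_envDeg (by ring) (W.gen_mem_envDeg _ _) ih) _)

theorem isUnitalFun_homotopyFun (hφ : (φ.f 0).hom V.one = W.one) (hψ : (ψ.f 0).hom V.one = W.one)
    (hH : (H.hom 0 1).hom V.one = 0) : V.IsUnitalFun (homotopyFun H) := by
  intro p q
  induction p with
  | nil => simp [homotopyFun_cons, unit, hφ, hH, W.gen_one]
  | cons a p ih =>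
    have hw := isUnitalFun_comp_wordMap hψ W.isUnitalFun_word p q
    simp only [Function.comp_apply] at hw
    simp only [List.cons_append, homotopyFun_cons, ih, hw]

theorem gen_homotopy (i : ℤ) (a : V.X.X i) :
    W.gen i ((W.X.d (i + 1) i).hom ((H.hom i (i + 1)).hom a)) +
      W.gen (i - 1 + 1) ((H.hom (i - 1) (i - 1 + 1)).hom (V.dLetter i a)) =
      W.gen i ((φ.f i).hom a) - W.gen i ((ψ.f i).hom a) := by
  have h : ∀ j, j = i → W.gen j ((H.hom (i - 1) j).hom (V.dLetter i a)) =
      W.gen i ((H.hom (i - 1) i).hom (V.dLetter i a)) := by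
    rintro j rfl
    rfl
  rw [h _ (by omega), homotopy_comm_apply H rfl (sub_add_cancel i 1), map_add, map_add,
    add_sub_cancel_right]
  rfl

theorem envD_homotopyFun_cons (a : V.Letter) (l : List V.Letter) :
    W.envD (homotopyFun H (a :: l)) =
      W.gen a.1 ((W.X.d (a.1 + 1) a.1).hom ((H.hom a.1 (a.1 + 1)).hom a.2)) *
          W.word (wordMap ψ l) -
        a.1.negOnePow • (W.gen (a.1 + 1) ((H.hom a.1 (a.1 + 1)).hom a.2) *
          W.envD (W.word (wordMap ψ l))) +
        a.1.negOnePow • (W.gen (a.1 - 1) ((φ.f (a.1 - 1)).hom (V.dLetter a.1 a.2)) *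
          homotopyFun H l) +
        W.gen a.1 ((φ.f a.1).hom a.2) * W.envD (homotopyFun H l) := by
  have hφ : (W.X.d a.1 (a.1 - 1)).hom ((φ.f a.1).hom a.2) = _ := dLetter_comm φ a.1 a.2
  rw [homotopyFun_cons, map_add, envD_gen_mul, W.envD_gen rfl, Int.negOnePow_succ, Units.neg_smul,
    Units.smul_def a.1.negOnePow (_ * homotopyFun H l), map_zsmul, ← Units.smul_def, envD_gen_mul,
    W.envD_gen (i' := a.1 - 1) (by omega), hφ, smul_add, negOnePow_smul_smul_self, ← sub_eq_add_neg,
    add_assoc]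

theorem derivFun_homotopyFun_cons (a : V.Letter) (l : List V.Letter) :
    derivFun V.dLetter (homotopyFun H) (a :: l) =
      W.gen (a.1 - 1 + 1) ((H.hom (a.1 - 1) (a.1 - 1 + 1)).hom (V.dLetter a.1 a.2)) *
          W.word (wordMap ψ l) -
        a.1.negOnePow • (W.gen (a.1 - 1) ((φ.f (a.1 - 1)).hom (V.dLetter a.1 a.2)) *
          homotopyFun H l) +
        a.1.negOnePow • (W.gen (a.1 + 1) ((H.hom a.1 (a.1 + 1)).hom a.2) *
          W.envD (W.word (wordMap ψ l))) +
        W.gen a.1 ((φ.f a.1).hom a.2) * derivFun V.dLetter (homotopyFun H) l := by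
  have hcons : (fun l => homotopyFun H (a :: l)) =
      LinearMap.mulLeft K (W.gen (a.1 + 1) ((H.hom a.1 (a.1 + 1)).hom a.2)) ∘
          W.word ∘ wordMap ψ +
        fun l => a.1.negOnePow •
          (LinearMap.mulLeft K (W.gen a.1 ((φ.f a.1).hom a.2)) ∘ homotopyFun H) l := rfl
  have hword : derivFun V.dLetter (W.word ∘ wordMap ψ) l = W.envD (W.word (wordMap ψ l)) := by
    rw [derivFun_comp_mapWord (dLetter_comm ψ)]
    exact (congrFun (comp_envD_word (V := W) LinearMap.id) _).symm
  have hpred : (a.1 - 1).negOnePow = -a.1.negOnePow := by rw [Int.negOnePow_sub]; simp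
  rw [derivFun_cons, hcons, derivFun_add, Pi.add_apply, derivFun_units_smul, derivFun_comp,
    derivFun_comp, Function.comp_apply, Function.comp_apply, hword, homotopyFun_cons, hpred,
    Units.neg_smul, smul_add, negOnePow_smul_smul_self, ← sub_eq_add_neg, ← add_assoc]
  rfl

theorem envD_homotopyFun :
    W.envD ∘ homotopyFun H + derivFun V.dLetter (homotopyFun H) =
      W.word ∘ wordMap φ - W.word ∘ wordMap ψ := by
  ext l
  induction l with
  | nil => simp [homotopyFun, derivFun, wordMap, mapWord]
  | cons a l ih =>
    have hgen := gen_homotopy H a.1 a.2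
    simp only [Pi.add_apply, Pi.sub_apply, Function.comp_apply] at ih ⊢
    calc W.envD (homotopyFun H (a :: l)) + derivFun V.dLetter (homotopyFun H) (a :: l)
      _ = (W.gen a.1 ((φ.f a.1).hom a.2) - W.gen a.1 ((ψ.f a.1).hom a.2)) *
            W.word (wordMap ψ l) +
          W.gen a.1 ((φ.f a.1).hom a.2) *
            (W.word (wordMap φ l) - W.word (wordMap ψ l)) := by
        rw [envD_homotopyFun_cons, derivFun_homotopyFun_cons, ← hgen, ← ih, add_mul, mul_add]
        abel
      _ = W.word (wordMap φ (a :: l)) - W.word (wordMap ψ (a :: l)) := by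
        simp only [wordMap, mapWord, List.map_cons, word_cons, sub_mul, mul_sub]
        abel

end HomotopyFun

section PointedHom

variable [CharZero K]

theorem exists_pointedMap_sub_eq {φ ψ : V.X ⟶ W.X} (hφ : (φ.f 0).hom V.one = W.one)
    (hψ : (ψ.f 0).hom V.one = W.one) (H : Homotopy φ ψ) (hH : (H.hom 0 1).hom V.one = 0) :
    ∃ k : V.Env →ₗ[K] W.Env, (∀ n, ∀ x ∈ V.envDeg n, k x ∈ W.envDeg (n + 1)) ∧
      pointedMap φ hφ - pointedMap ψ hψ = W.envD ∘ₗ k + k ∘ₗ V.envD := by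
  obtain ⟨k, hk, hdeg⟩ := exists_symFun_comp_word_eq (homotopyFun_mem_multilinearFun H)
    (isUnitalFun_homotopyFun H hφ hψ hH)
  refine ⟨k, hdeg, env_linearMap_ext_symFun ?_⟩
  calc symFun K (pointedMap φ hφ ∘ V.word - pointedMap ψ hψ ∘ V.word)
    _ = symFun K (W.envD ∘ homotopyFun H + derivFun V.dLetter (homotopyFun H)) := by
      rw [symFun_sub, symFun_pointedMap, symFun_pointedMap, ← symFun_sub, envD_homotopyFun]
    _ = symFun K (W.envD ∘ k ∘ V.word + derivFun V.dLetter (k ∘ V.word)) := by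
      rw [symFun_add, symFun_add, symFun_comp, symFun_comp, symFun_derivFun, symFun_derivFun, hk]
    _ = symFun K ((W.envD ∘ₗ k + k ∘ₗ V.envD) ∘ V.word) := by
      rw [← comp_envD_word]
      rfl

/-- `pointedMap` as a chain map between the enveloping algebras. -/
noncomputable def pointedHom (g : V.X ⟶ W.X) (hg : (g.f 0).hom V.one = W.one) :
    V.envComplex ⟶ W.envComplex where
  f n := ModuleCat.ofHom
    ((pointedMap g hg).restrict fun _ => pointedMap_mem g hg : V.envDeg n →ₗ[K] W.envDeg n)
  comm' i j h := by
    ext x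
    refine (W.envComplex_d_apply h _).trans (Subtype.ext ?_)
    refine (DFunLike.congr_fun (envD_pointedMap g hg) x.1).trans ?_
    exact (congrArg (fun y : V.envDeg j => pointedMap g hg y.1) (V.envComplex_d_apply h x)).symm

theorem pointedHom_hom (f : V ⟶ W) : pointedHom f.hom f.map_one = (envelopeMap f).hom := by
  ext n x
  exact Subtype.ext (DFunLike.congr_fun (pointedMap_hom f) x.1)

theorem pointedHom_id : pointedHom (𝟙 V.X) rfl = 𝟙 V.envComplex := by
  ext n x
  exact Subtype.ext (DFunLike.congr_fun pointedMap_id x.1)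

theorem pointedHom_comp (g : U.X ⟶ V.X) (hg) (g' : V.X ⟶ W.X) (hg') (hgg') :
    pointedHom g hg ≫ pointedHom g' hg' = pointedHom (g ≫ g') hgg' := by
  ext n x
  exact Subtype.ext (DFunLike.congr_fun (pointedMap_comp g hg g' hg' hgg') x.1)

end PointedHom

/-- The chain homotopy given by a linear map of degree one between the enveloping algebras. -/
noncomputable def envHomotopy {φ ψ : V.envComplex ⟶ W.envComplex} (k : V.Env →ₗ[K] W.Env)
    (hk : ∀ n, ∀ x ∈ V.envDeg n, k x ∈ W.envDeg (n + 1))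
    (h : ∀ n (x : V.envDeg n), ((φ.f n).hom x : W.envDeg n).1 - ((ψ.f n).hom x : W.envDeg n).1 =
      W.envD (k x) + k (V.envD x)) : Homotopy φ ψ :=
  homotopyMk (fun i j hij => (k.restrict fun x hx => hij ▸ hk i x hx : V.envDeg i →ₗ[K] W.envDeg j))
    fun {i j l} hi hl x => by
      refine Subtype.ext (sub_eq_iff_eq_add.1 ((h j x).trans ?_))
      refine (congrArg₂ (· + ·) ?_ ?_).symm
      · exact congrArg Subtype.val (W.envComplex_d_apply hi _)
      · exact congrArg (fun y : V.envDeg l => k y.1) (V.envComplex_d_apply hl x)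

theorem nonempty_homotopy_pointedHom [CharZero K] {φ ψ : V.X ⟶ W.X}
    (hφ : (φ.f 0).hom V.one = W.one) (hψ : (ψ.f 0).hom V.one = W.one) (H : Homotopy φ ψ)
    (hH : (H.hom 0 1).hom V.one = 0) :
    Nonempty (Homotopy (pointedHom φ hφ) (pointedHom ψ hψ)) := by
  obtain ⟨k, hk, h⟩ := exists_pointedMap_sub_eq hφ hψ H hH
  exact ⟨envHomotopy k hk fun n x => DFunLike.congr_fun h x.1⟩

end ULieAlg

/-! ### Homotopy inverses over a field -/

section QuasiIso

variable {K : Type u} [Field K] {C D : ChainComplex (ModuleCat.{v} K) ℤ}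

theorem exists_eq_d_of_quasiIso (f : C ⟶ D) [QuasiIso f] {i j k : ℤ} (hi : j + 1 = i)
    (hj : k + 1 = j) (x : C.X j) (hx : (C.d j k).hom x = 0) (y : D.X i)
    (hy : (f.f j).hom x = (D.d i j).hom y) : ∃ x' : C.X i, x = (C.d i j).hom x' := by
  let P : Submodule K (C.X j × D.X i) :=
    LinearMap.ker ((C.d j k).hom ∘ₗ LinearMap.fst K _ _) ⊓
      LinearMap.ker ((f.f j).hom ∘ₗ LinearMap.fst K _ _ - (D.d i j).hom ∘ₗ LinearMap.snd K _ _)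
  have hmono : Mono (HomologicalComplex.homologyMap f j) := inferInstance
  rw [HomologicalComplex.mono_homologyMap_iff_up_to_refinements f i j k
    ((ComplexShape.down ℤ).prev_eq' hi) ((ComplexShape.down ℤ).next_eq' hj)] at hmono
  obtain ⟨A, π, hπ, x', h⟩ := hmono (A := ModuleCat.of K P)
    (ModuleCat.ofHom (LinearMap.fst K _ _ ∘ₗ P.subtype)) (by ext p; exact p.2.1)
    (ModuleCat.ofHom (LinearMap.snd K _ _ ∘ₗ P.subtype)) (by ext p; exact sub_eq_zero.1 p.2.2)
  obtain ⟨a, ha⟩ := (ModuleCat.epi_iff_surjective π).1 hπ ⟨(x, y), hx, sub_eq_zero.2 hy⟩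
  have hxa : (π.hom a).1.1 = _ := DFunLike.congr_fun (congrArg ModuleCat.Hom.hom h) a
  rw [show π.hom a = _ from ha] at hxa
  exact ⟨x'.hom a, hxa⟩

theorem exists_eq_add_d_of_quasiIso (f : C ⟶ D) [QuasiIso f] {i j k : ℤ} (hi : j + 1 = i)
    (hj : k + 1 = j) (y : D.X j) (hy : (D.d j k).hom y = 0) :
    ∃ (x : C.X j) (y' : D.X i), (C.d j k).hom x = 0 ∧ y = (f.f j).hom x + (D.d i j).hom y' := by
  have hepi : Epi (HomologicalComplex.homologyMap f j) := inferInstance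
  rw [HomologicalComplex.epi_homologyMap_iff_up_to_refinements f i j k
    ((ComplexShape.down ℤ).prev_eq' hi) ((ComplexShape.down ℤ).next_eq' hj)] at hepi
  obtain ⟨A, π, hπ, x, hx, y', h⟩ := hepi (A := ModuleCat.of K (LinearMap.ker (D.d j k).hom))
    (ModuleCat.ofHom (LinearMap.ker (D.d j k).hom).subtype) (by ext p; exact p.2)
  obtain ⟨a, ha⟩ := (ModuleCat.epi_iff_surjective π).1 hπ ⟨y, hy⟩
  have hya : (π.hom a).1 = _ := DFunLike.congr_fun (congrArg ModuleCat.Hom.hom h) a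
  rw [show π.hom a = _ from ha] at hya
  exact ⟨x.hom a, y'.hom a, DFunLike.congr_fun (congrArg ModuleCat.Hom.hom hx) a, hya⟩

theorem d_hom_d_hom (C : ChainComplex (ModuleCat.{v} K) ℤ) (i j k : ℤ) (x : C.X i) :
    (C.d j k).hom ((C.d i j).hom x) = 0 := by
  rw [← LinearMap.comp_apply, ← ModuleCat.hom_comp, C.d_comp_d]
  rfl

theorem d_hom_f_hom (f : C ⟶ D) (i j : ℤ) (x : C.X i) :
    (D.d i j).hom ((f.f i).hom x) = (f.f j).hom ((C.d i j).hom x) := by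
  rw [← LinearMap.comp_apply, ← ModuleCat.hom_comp, f.comm]
  rfl

end QuasiIso

section ConeContraction

variable {K : Type u} [Field K] {C D : ChainComplex (ModuleCat.{v} K) ℤ}

/-- The differential of the mapping cone of `f`. -/
def coneD (f : C ⟶ D) (i j k : ℤ) : (C.X j × D.X i) →ₗ[K] (C.X k × D.X j) :=
  LinearMap.prod (-((C.d j k).hom ∘ₗ LinearMap.fst K _ _))
    ((f.f j).hom ∘ₗ LinearMap.fst K _ _ + (D.d i j).hom ∘ₗ LinearMap.snd K _ _)

theorem coneD_apply (f : C ⟶ D) (i j k : ℤ) (x : C.X j) (y : D.X i) :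
    coneD f i j k (x, y) = (-(C.d j k).hom x, (f.f j).hom x + (D.d i j).hom y) := rfl

theorem coneD_coneD (f : C ⟶ D) (i j k l : ℤ) (p : C.X j × D.X i) :
    coneD f j k l (coneD f i j k p) = 0 := by
  obtain ⟨x, y⟩ := p
  simp [coneD_apply, d_hom_d_hom, d_hom_f_hom]

theorem exists_coneD_eq (f : C ⟶ D) [QuasiIso f] {i j k l : ℤ} (hi : j + 1 = i) (hj : k + 1 = j)
    (hk : l + 1 = k) (p : C.X k × D.X j) (hp : coneD f j k l p = 0) :
    ∃ q, coneD f i j k q = p := by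
  obtain ⟨x, y⟩ := p
  rw [coneD_apply, Prod.mk_eq_zero, neg_eq_zero] at hp
  obtain ⟨x₁, hx₁⟩ := exists_eq_d_of_quasiIso f hj hk x hp.1 (-y)
    (by rw [map_neg, eq_neg_iff_add_eq_zero, hp.2])
  obtain ⟨x₂, y₂, hx₂, hy₂⟩ := exists_eq_add_d_of_quasiIso f hi hj ((f.f j).hom x₁ + y)
    (by rw [map_add, d_hom_f_hom, ← hx₁, hp.2])
  refine ⟨(x₂ - x₁, y₂), Prod.ext ?_ ?_⟩
  · simp [coneD_apply, hx₂, hx₁]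
  · simp only [coneD_apply, map_sub]
    rw [sub_add_eq_add_sub, ← hy₂, add_sub_cancel_left]

/-- A contraction of the mapping cone of `f`. The map has a component for every triple of indices,
but only the components with consecutive indices are meaningful. -/
structure ConeContraction (f : C ⟶ D) where
  /-- The components of the contraction. -/
  map (i j k : ℤ) : (C.X k × D.X j) →ₗ[K] (C.X j × D.X i)
  coneD_map_add {i j k l : ℤ} (hi : j + 1 = i) (hj : k + 1 = j) (hk : l + 1 = k)
    (p : C.X k × D.X j) : coneD f i j k (map i j k p) + map j k l (coneD f j k l p) = p

namespace ConeContraction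

variable {f : C ⟶ D} (S : ConeContraction f) {i j k l : ℤ}

theorem d_fst_map (hi : j + 1 = i) (hj : k + 1 = j) (hk : l + 1 = k) (y : D.X j) :
    (C.d j k).hom (S.map i j k (0, y)).1 = (S.map j k l (0, (D.d j k).hom y)).1 := by
  have h := congrArg Prod.fst (S.coneD_map_add hi hj hk (0, y))
  rw [coneD_apply f j k l, map_zero, map_zero, neg_zero, zero_add] at h
  exact neg_add_eq_zero.1 h

theorem fst_map_add (hi : j + 1 = i) (hj : k + 1 = j) (hk : l + 1 = k) (y : D.X j) :
    (f.f j).hom (S.map i j k (0, y)).1 + (D.d i j).hom (S.map i j k (0, y)).2 +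
      (S.map j k l (0, (D.d j k).hom y)).2 = y := by
  have h := congrArg Prod.snd (S.coneD_map_add hi hj hk (0, y))
  rwa [coneD_apply f j k l, map_zero, map_zero, neg_zero, zero_add] at h

theorem fst_map_f (hi : j + 1 = i) (hj : k + 1 = j) (hk : l + 1 = k) (x : C.X k) :
    (S.map j k l (0, (f.f k).hom x)).1 =
      (C.d j k).hom (S.map i j k (x, 0)).1 + (S.map j k l ((C.d k l).hom x, 0)).1 + x := by
  have h := congrArg Prod.fst (S.coneD_map_add hi hj hk (x, 0))
  have hcone : coneD f j k l (x, 0) = (0, (f.f k).hom x) - ((C.d k l).hom x, 0) := by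
    simp [coneD_apply]
  rw [hcone, map_sub] at h
  have h' : -(C.d j k).hom (S.map i j k (x, 0)).1 + ((S.map j k l (0, (f.f k).hom x)).1 -
    (S.map j k l ((C.d k l).hom x, 0)).1) = x := h
  rw [neg_add_eq_sub, sub_sub, sub_eq_iff_eq_add'] at h'
  rw [h', add_comm (S.map j k l _).1]

/-- The component in degree `j` of the homotopy inverse of `f` given by a contraction of its mapping
cone. -/
def invLinear (j : ℤ) : D.X j →ₗ[K] C.X j :=
  LinearMap.fst K _ _ ∘ₗ S.map (j + 1) j (j - 1) ∘ₗ LinearMap.inr K _ _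

theorem invLinear_apply (hi : j + 1 = i) (hk : k + 1 = j) (y : D.X j) :
    S.invLinear j y = (S.map i j k (0, y)).1 := by
  obtain rfl : k = j - 1 := by omega
  subst hi
  rfl

/-- The homotopy inverse of `f` given by a contraction of its mapping cone. -/
def inv : D ⟶ C where
  f j := ModuleCat.ofHom (S.invLinear j)
  comm' i j hij := by
    ext y
    change (C.d i j).hom (S.invLinear i y) = S.invLinear j ((D.d i j).hom y)
    rw [S.invLinear_apply rfl hij, S.invLinear_apply hij (sub_add_cancel j 1),
      S.d_fst_map rfl hij (sub_add_cancel j 1)]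

/-- The homotopy from `f ≫ S.inv` to the identity. -/
def homotopyHomInvId : Homotopy (f ≫ S.inv) (𝟙 C) :=
  homotopyMk (fun i j _ => LinearMap.fst K _ _ ∘ₗ S.map (j + 1) j i ∘ₗ LinearMap.inl K _ _)
    fun {i j k} hi hk x => by
      subst hi hk
      exact (S.invLinear_apply rfl rfl _).trans (S.fst_map_f rfl rfl rfl x)

/-- The homotopy from `S.inv ≫ f` to the identity. -/
def homotopyInvHomId : Homotopy (S.inv ≫ f) (𝟙 D) :=
  homotopyMk (fun i j _ => -(LinearMap.snd K _ _ ∘ₗ S.map j i (i - 1) ∘ₗ LinearMap.inr K _ _))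
    fun {i j k} hi hk x => by
      obtain rfl : k = j - 1 := by omega
      subst hi
      rw [LinearMap.neg_apply, LinearMap.neg_apply, map_neg, add_assoc, ← sub_eq_iff_eq_add',
        sub_neg_eq_add, neg_add_eq_sub, eq_sub_iff_add_eq]
      exact S.fst_map_add rfl hk (sub_add_cancel (j - 1) 1) x

end ConeContraction

theorem exists_generalizedInverse {E F : Type*} [AddCommGroup E] [Module K E] [AddCommGroup F]
    [Module K F] (d : E →ₗ[K] F) (u : E) (hu : d u = 0 → u = 0) :
    ∃ σ : F →ₗ[K] E, (∀ w, d (σ (d w)) = d w) ∧ σ (d u) = u := by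
  have hdisj : Disjoint (LinearMap.ker d) (K ∙ u) := by
    rw [Submodule.disjoint_span_singleton]
    exact hu
  obtain ⟨Q, hQu, hQ⟩ := hdisj.symm.exists_isCompl
  obtain ⟨g, hg⟩ := (d.domRestrict Q).exists_leftInverse_of_injective
    (LinearMap.ker_eq_bot'.2 fun w hw => Subtype.ext (hQ.disjoint.le_bot ⟨w.2, hw⟩))
  have hgd : ∀ w : Q, g (d w) = w := DFunLike.congr_fun hg
  refine ⟨Q.subtype ∘ₗ g, fun w => ?_, ?_⟩
  · obtain ⟨w, hw, v, hv, rfl⟩ := Submodule.mem_sup.1 (hQ.sup_eq_top ▸ Submodule.mem_top (x := w))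
    rw [map_add, LinearMap.mem_ker.1 hv, add_zero]
    exact congrArg d (congrArg Subtype.val (hgd ⟨w, hw⟩))
  · exact congrArg Subtype.val (hgd ⟨u, hQu (Submodule.mem_span_singleton_self u)⟩)

theorem exists_coneContraction (f : C ⟶ D) [QuasiIso f] (u : ∀ j, C.X j)
    (hu : ∀ {j k}, k + 1 = j → (C.d j k).hom (u j) = 0)
    (hfu : ∀ j, (f.f j).hom (u j) = 0 → u j = 0) :
    ∃ S : ConeContraction f, ∀ {i j k}, j + 1 = i → k + 1 = j →
      S.map i j k (0, (f.f j).hom (u j)) = (u j, 0) ∧ S.map i j k (u k, 0) = 0 := by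
  have hcone : ∀ {i j k}, k + 1 = j → coneD f i j k (u j, 0) = (0, (f.f j).hom (u j)) :=
    fun hk => by simp [coneD_apply, hu hk]
  choose σ hσ hσu using fun i j k => exists_generalizedInverse (coneD f i j k) (u j, 0)
    fun h => by
      rw [coneD_apply, map_zero, add_zero, Prod.mk_eq_zero] at h
      rw [hfu j h.2, Prod.mk_zero_zero]
  refine ⟨⟨fun i j k => σ i j k ∘ₗ (LinearMap.id - σ j k (k - 1) ∘ₗ coneD f j k (k - 1)),
    fun {i j k l} hi hj hk p => ?_⟩, fun {i j k} _ hj => ⟨?_, ?_⟩⟩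
  · obtain rfl : l = k - 1 := by omega
    obtain ⟨q, hq⟩ := exists_coneD_eq f hi hj hk (p - σ j k (k - 1) (coneD f j k (k - 1) p))
      (by rw [map_sub, hσ, sub_self])
    simp only [LinearMap.comp_apply, LinearMap.sub_apply, LinearMap.id_apply, coneD_coneD, map_zero,
      sub_zero]
    rw [← hq, hσ, hq, sub_add_cancel]
  · simp only [← hcone (i := i) hj, LinearMap.comp_apply, LinearMap.sub_apply, LinearMap.id_apply,
      coneD_coneD, map_zero, sub_zero, hσu]
  · simp only [LinearMap.comp_apply, LinearMap.sub_apply, LinearMap.id_apply, hσu, sub_self,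
      map_zero]

theorem exists_homotopyInverse (f : C ⟶ D) [QuasiIso f] (u : ∀ j, C.X j)
    (hu : ∀ {j k}, k + 1 = j → (C.d j k).hom (u j) = 0)
    (hfu : ∀ j, (f.f j).hom (u j) = 0 → u j = 0) :
    ∃ (g : D ⟶ C) (H : Homotopy (f ≫ g) (𝟙 C)) (H' : Homotopy (g ≫ f) (𝟙 D)),
      (∀ j, (g.f j).hom ((f.f j).hom (u j)) = u j) ∧
      ∀ {i j}, i + 1 = j → (H.hom i j).hom (u i) = 0 ∧
        (H'.hom i j).hom ((f.f i).hom (u i)) = 0 := by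
  obtain ⟨S, hS⟩ := exists_coneContraction f u hu hfu
  refine ⟨S.inv, S.homotopyHomInvId, S.homotopyInvHomId, fun j => ?_, fun {i j} hij => ⟨?_, ?_⟩⟩
  · exact (S.invLinear_apply rfl (sub_add_cancel j 1) _).trans
      (congrArg Prod.fst (hS rfl (sub_add_cancel j 1)).1)
  · exact (homotopyMk_hom_apply _ _ hij _).trans (congrArg Prod.fst (hS rfl hij).2)
  · refine (homotopyMk_hom_apply _ _ hij _).trans (neg_eq_zero.2 ?_)
    exact congrArg Prod.snd (hS hij (sub_add_cancel i 1)).1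

end ConeContraction

namespace ULieAlg

variable {K : Type u} [Field K] {V W : ULieAlg.{u, v} K}

theorem nonempty_homotopy_id_zero {x : V.X.X 1} (hx : (V.X.d 1 0).hom x = V.one) :
    Nonempty (Homotopy (𝟙 V.envComplex) 0) := by
  have hd : V.envD (V.gen 1 x) = 1 := by rw [V.envD_gen (i := 1) (i' := 0) rfl, hx, V.gen_one]
  refine ⟨envHomotopy (LinearMap.mulLeft K (V.gen 1 x))
    (fun n z hz => V.mul_mem_envDeg (add_comm 1 n) (V.gen_mem_envDeg 1 x) hz) fun n z => ?_⟩
  rw [LinearMap.mulLeft_apply, LinearMap.mulLeft_apply, envD_gen_mul, hd, one_mul,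
    Int.negOnePow_one, Units.neg_smul, one_smul, neg_add_cancel_right]
  exact sub_zero z.1

theorem quasiIso_envelopeMap_of_d_eq_one (f : V ⟶ W) {x : V.X.X 1}
    (hx : (V.X.d 1 0).hom x = V.one) : QuasiIso (envelopeMap f).hom := by
  obtain ⟨H⟩ := nonempty_homotopy_id_zero hx
  obtain ⟨H'⟩ := nonempty_homotopy_id_zero (V := W) (x := (f.hom.f 1).hom x)
    (by rw [d_hom_f_hom, hx, f.map_one])
  let E : HomotopyEquiv V.envComplex W.envComplex :=
    { hom := (envelopeMap f).hom
      inv := 0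
      homotopyHomInvId := (Homotopy.ofEq Limits.comp_zero).trans H.symm
      homotopyInvHomId := (Homotopy.ofEq Limits.zero_comp).trans H'.symm }
  exact E.quasiIso_hom

theorem exists_pointed_homotopyInverse (f : V ⟶ W) [QuasiIso f.hom] (hW : W.one ≠ 0) :
    ∃ (g : W.X ⟶ V.X) (H : Homotopy (f.hom ≫ g) (𝟙 V.X)) (H' : Homotopy (g ≫ f.hom) (𝟙 W.X)),
      (g.f 0).hom W.one = V.one ∧ (H.hom 0 1).hom V.one = 0 ∧ (H'.hom 0 1).hom W.one = 0 := by
  have hone : ∀ j ≠ 0, (Pi.single 0 V.one : ∀ j, V.X.X j) j = 0 :=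
    fun j hj => Pi.single_eq_of_ne hj _
  obtain ⟨g, H, H', hg, hH⟩ := exists_homotopyInverse f.hom (Pi.single 0 V.one)
    (fun {j k} hk => by
      rcases eq_or_ne j 0 with rfl | hj
      · obtain rfl : k = -1 := by omega
        rw [Pi.single_eq_same, V.d_one]
      · rw [hone j hj, map_zero])
    (fun j h => by
      rcases eq_or_ne j 0 with rfl | hj
      · rw [Pi.single_eq_same, f.map_one] at h
        exact absurd h hW
      · exact hone j hj)
  have hg₀ := hg 0
  have hH₀ := hH (zero_add 1)
  rw [Pi.single_eq_same, f.map_one] at hg₀ hH₀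
  exact ⟨g, H, H', hg₀, hH₀⟩

theorem quasiIso_envelopeMap_of_one_ne_zero [CharZero K] (f : V ⟶ W) [QuasiIso f.hom]
    (hW : W.one ≠ 0) : QuasiIso (envelopeMap f).hom := by
  obtain ⟨g, H, H', hg, hH, hH'⟩ := exists_pointed_homotopyInverse f hW
  have hfg : ((f.hom ≫ g).f 0).hom V.one = V.one := (congrArg _ f.map_one).trans hg
  have hgf : ((g ≫ f.hom).f 0).hom W.one = W.one := (congrArg _ hg).trans f.map_one
  obtain ⟨E⟩ := nonempty_homotopy_pointedHom hfg rfl H hH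
  obtain ⟨E'⟩ := nonempty_homotopy_pointedHom hgf rfl H' hH'
  let e : HomotopyEquiv V.envComplex W.envComplex :=
    { hom := pointedHom f.hom f.map_one
      inv := pointedHom g hg
      homotopyHomInvId := (Homotopy.ofEq (pointedHom_comp _ _ _ _ hfg)).trans
        (E.trans (Homotopy.ofEq pointedHom_id))
      homotopyInvHomId := (Homotopy.ofEq (pointedHom_comp _ _ _ _ hgf)).trans
        (E'.trans (Homotopy.ofEq pointedHom_id)) }
  rw [← pointedHom_hom]
  exact e.quasiIso_hom

end ULieAlg

theorem lemmaA1 (K : Type u) [Field K] [CharZero K] {V W : ULieAlg.{u, v} K} (f : V ⟶ W)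
    (hf : ULieAlg.weakEquivalences K f) :
    AsAlg.weakEquivalences K ((phiShriek K).map f) := by
  have : QuasiIso f.hom := hf
  change QuasiIso (ULieAlg.envelopeMap f).hom
  by_cases hW : W.one = 0
  · obtain ⟨x, hx⟩ : ∃ x : V.X.X 1, V.one = (V.X.d 1 0).hom x :=
      exists_eq_d_of_quasiIso f.hom (zero_add 1) (neg_add_cancel 1) V.one V.d_one 0
        (by rw [f.map_one, hW, map_zero])
    exact ULieAlg.quasiIso_envelopeMap_of_d_eq_one f hx.symm
  · exact ULieAlg.quasiIso_envelopeMap_of_one_ne_zero f hW
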